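/- Let $k$ be a field of characteristic zero, $\mathcal A$ an associative unital $k$-algebra, $R$ a commutative unital $k$-algebra and $\phi:\mathcal A\to R$ a $k$-linear map with $\phi(1)=1$. The free cumulants $\kappa_n:\mathcal A^n\to R$ are defined recursively by $\phi(a_1\cdots a_n)=\sum_{\pi\in NC(n)}\prod_{V\in\pi}\kappa_{|V|}\big((a_v)_{v\in V}\big)$, $n\ge 1$. Elements $a,b\in\mathcal A$ are *(combinatorially) free* if $\kappa_m(x_1,\dots,x_m)=0$ for all mixed arguments, i.e. whenever $x_j\in\{a\}$ or $x_j\in\{b\}$ for each $j$ and both cases occur. The distribution $\mu_a: k[z]\to R$, $z^n\mapsto\phi(a^n)$, is identified with the series $\sum_{n\ge1}\phi(a^n)z^n$. Let $\mathfrak M^1(R)=zR[[z]]$ and $\mathfrak G^1_+(R)=z+z^2R[[z]]$. For $f=\sum_{n\ge 1} f_nz^n$ and $g=\sum_{n\ge 1} g_nz^n$ in $\mathfrak M^1(R)$, the boxed convolution $f\boxtimes g$ has coefficients $(f\boxtimes g)_n=\sum_{\pi\in NC(n)}\prod_{V\in\pi}f_{|V|}\prod_{W\in K(\pi)}g_{|W|}$,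 where $K(\pi)$ is the Kreweras complement. Let $\mathrm{Zeta}_1=\sum_{n\ge1}z^n$, let $\mathrm{Moeb}_1$ be its $\boxtimes$-inverse (the unit of $\boxtimes$ being $z$), and put $$f\boxplus_V g=(f\boxtimes\mathrm{Moeb}_1+g\boxtimes\mathrm{Moeb}_1)\boxtimes\mathrm{Zeta}_1,\qquad f\boxtimes_V g=f\boxtimes\mathrm{Moeb}_1\boxtimes g .$$ For $f\in\mathfrak G^1_+(R)$ let $\mathcal F(f)=\frac1z f^{-1}(z)$, with $f^{-1}$ the inverse of $f$ under composition. Let $\mathrm{LOG}:\mathfrak G^1_+(R)\to\mathfrak M^1(R)$ be the bijection $\mathrm{LOG}(f)=\frac{d}{dz}\log\mathcal F(f)$, where $R[[z]]$ is identified with $\mathfrak M^1(R)=zR[[z]]$ through the sequence of coefficients (i.e. by multiplication with $z$). Let $\mathrm{EXP}=\mathrm{LOG}^{-1}$, let $$\mathrm{EXP}_V:\mathfrak M^1(R)\to\mathfrak G^1_+(R),\qquad \mathrm{EXP}_V(f)=\mathrm{EXP}(f\boxtimes\mathrm{Moeb}_1)\boxtimes\mathrm{Zeta}_1,$$ which is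 a bijection, and let $\mathrm{LOG}_V=\mathrm{EXP}_V^{-1}$. **Corollary.** Let $a,b\in\mathcal A$ be combinatorially free. Then 1. $\mathrm{EXP}_V(\mu_{0_{\mathcal A}})=\mu_{1_{\mathcal A}}=\mathrm{Zeta}_1$; 2. $\mathrm{EXP}_V(\mu_a\boxplus_V\mu_b)=\mathrm{EXP}_V(\mu_a)\boxtimes_V\mathrm{EXP}_V(\mu_b)$; 3. if in addition $\phi(a)=\phi(b)=1_R$, then $\phi(ab)=1_R$ and $\mu_{ab}=\mathrm{EXP}_V\big(\mathrm{LOG}_V(\mu_a)\boxplus_V\mathrm{LOG}_V(\mu_b)\big)$. -/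

import Mathlib

open scoped PowerSeries

noncomputable section

namespace FreeProb

/-! ## Non-crossing partitions and the Kreweras complement -/

/-- Partitions of `[n]`, the points being numbered `0, …, n - 1`. -/
abbrev Part (n : ℕ) : Type := Finpartition (Finset.univ : Finset (Fin n))

/-- `p ∼_π q`: the points `p` and `q` lie in the same block of `π`. -/
def SameBlock {n : ℕ} (π : Part n) (p q : Fin n) : Prop :=
  ∃ V ∈ π.parts, p ∈ V ∧ q ∈ V

instance {n : ℕ} (π : Part n) : DecidableRel (SameBlock π) := fun p q => by
  unfold SameBlock; infer_instance

/-- An equivalence relation `r` on an ordered set is non-crossing if there are no points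
`p₁ < q₁ < p₂ < q₂` with `p₁ ∼ p₂`, `q₁ ∼ q₂` and `q₁ ≁ p₂`. -/
def NonCrossingRel {α : Type*} [LT α] (r : α → α → Prop) : Prop :=
  ∀ p₁ q₁ p₂ q₂ : α, p₁ < q₁ → q₁ < p₂ → p₂ < q₂ → r p₁ p₂ → r q₁ q₂ → r q₁ p₂

/-- The partition `π` of `[n]` is non-crossing. -/
def IsNonCrossing {n : ℕ} (π : Part n) : Prop := NonCrossingRel (SameBlock π)

instance {n : ℕ} : DecidablePred (IsNonCrossing (n := n)) := fun π => by
  unfold IsNonCrossing NonCrossingRel; infer_instance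

/-- The finite set `NC(n)` of non-crossing partitions of `[n]`. -/
def NC (n : ℕ) : Finset (Part n) := Finset.univ.filter IsNonCrossing

/-- The equivalence relation of `π ∪ σ` on `1 < 1̄ < 2 < 2̄ < ⋯ < n < n̄`, where `π` partitions
`{1, …, n}` and `σ` partitions `{1̄, …, n̄}`. The point `i` is `(i, false)`, and `ī` is
`(i, true)`, in lexicographic order. -/
def UnionRel {n : ℕ} (π σ : Part n) (x y : Fin n ×ₗ Bool) : Prop :=
  ((ofLex x).2 = false ∧ (ofLex y).2 = false ∧ SameBlock π (ofLex x).1 (ofLex y).1) ∨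
  ((ofLex x).2 = true ∧ (ofLex y).2 = true ∧ SameBlock σ (ofLex x).1 (ofLex y).1)

/-- The equivalence relation of the Kreweras complement of `π`: no block of `π` has points both
between and outside of `ī` and `j̄`. (The point `p` lies between `ī` and `j̄` if and only if
`p ≤ i ↔ p ≤ j` fails.) See `kreweras_isGreatest`. -/
def krewerasSetoid {n : ℕ} (π : Part n) : Setoid (Fin n) where
  r i j := ∀ p q, SameBlock π p q → ((p ≤ i ↔ p ≤ j) ↔ (q ≤ i ↔ q ≤ j))
  iseqv := ⟨fun _ _ _ _ => by simp, fun h p q hpq => by have := h p q hpq; tauto,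
    fun h₁ h₂ p q hpq => by have := h₁ p q hpq; have := h₂ p q hpq; tauto⟩

instance {n : ℕ} (π : Part n) : DecidableRel (krewerasSetoid π).r := fun i j =>
  inferInstanceAs (Decidable
    (∀ p q, SameBlock π p q → ((p ≤ i ↔ p ≤ j) ↔ (q ≤ i ↔ q ≤ j))))

/-- The Kreweras complement `K(π)`. -/
def kreweras {n : ℕ} (π : Part n) : Part n := Finpartition.ofSetoid (krewerasSetoid π)

theorem sameBlock_iff_mem_part {n : ℕ} (π : Part n) (p q : Fin n) :
    SameBlock π p q ↔ q ∈ π.part p := by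
  rw [Finpartition.mem_part_iff_exists]
  unfold SameBlock
  constructor <;> rintro ⟨V, h, h1, h2⟩ <;> exact ⟨V, h, h2, h1⟩

theorem sameBlock_kreweras {n : ℕ} (π : Part n) (i j : Fin n) :
    SameBlock (kreweras π) i j ↔
      ∀ p q, SameBlock π p q → ((p ≤ i ↔ p ≤ j) ↔ (q ≤ i ↔ q ≤ j)) := by
  rw [sameBlock_iff_mem_part]
  exact Finpartition.mem_part_ofSetoid_iff_rel

theorem sameBlock_symm {n : ℕ} {π : Part n} {p q : Fin n} (h : SameBlock π p q) :
    SameBlock π q p := by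
  obtain ⟨V, h, h1, h2⟩ := h
  exact ⟨V, h, h2, h1⟩

theorem le_of_sameBlock {n : ℕ} {π σ : Part n}
    (h : ∀ p q, SameBlock π p q → SameBlock σ p q) : π ≤ σ := by
  intro V hV
  obtain ⟨p, hp⟩ := π.nonempty_of_mem_parts hV
  refine ⟨σ.part p, σ.part_mem.2 (Finset.mem_univ p), fun q hq => ?_⟩
  exact (sameBlock_iff_mem_part σ p q).1 (h p q ⟨V, hV, hp, hq⟩)

/-- `K(π)` is the largest non-crossing partition `σ` of `{1̄, …, n̄}` such that `π ∪ σ` is a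
non-crossing partition of `1 < 1̄ < 2 < 2̄ < ⋯ < n < n̄`. -/
theorem kreweras_isGreatest {n : ℕ} (π : Part n) (hπ : IsNonCrossing π) :
    IsGreatest {σ : Part n | IsNonCrossing σ ∧ NonCrossingRel (UnionRel π σ)} (kreweras π) := by
  have hK : IsNonCrossing (kreweras π) := by
    intro i₁ j₁ i₂ j₂ h1 h2 h3 hi hj
    rw [sameBlock_kreweras] at *
    intro p q hpq
    have := hi p q hpq
    have := hj p q hpq
    grind
  refine ⟨⟨hK, ?_⟩, ?_⟩
  · intro p₁ q₁ p₂ q₂ h1 h2 h3 hp hq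
    rw [Prod.Lex.lt_iff] at h1 h2 h3
    unfold UnionRel at *
    rcases hp with ⟨a1, a2, hp⟩ | ⟨a1, a2, hp⟩ <;> rcases hq with ⟨b1, b2, hq⟩ | ⟨b1, b2, hq⟩ <;>
      simp only [a1, a2, b1, b2, lt_self_iff_false, and_false, or_false, Bool.false_lt_true,
        and_true, show ¬ true < false by decide] at h1 h2 h3 ⊢
    · simpa using hπ _ _ _ _ h1 h2 h3 hp hq
    · have := (sameBlock_kreweras _ _ _).1 hq _ _ hp
      grind
    · have := (sameBlock_kreweras _ _ _).1 hp _ _ hq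
      grind
    · simpa using hK _ _ _ _ h1 h2 h3 hp hq
  · rintro σ ⟨-, hσ⟩
    have key : ∀ i j, i ≤ j → SameBlock σ i j → SameBlock (kreweras π) i j := by
      intro i j hij h
      rw [sameBlock_kreweras]
      have aux : ∀ p q, SameBlock π p q → i < p → p ≤ j → i < q ∧ q ≤ j := by
        intro p q hpq hp1 hp2
        by_contra hcon
        rcases lt_or_ge i q with hq | hq
        · have hq : j < q := by grind
          have := hσ (toLex (i, true)) (toLex (p, false)) (toLex (j, true)) (toLex (q, false))
            (by rw [Prod.Lex.lt_iff]; exact Or.inl hp1)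
            (by rw [Prod.Lex.lt_iff]
                rcases hp2.lt_or_eq with h | h
                · exact Or.inl h
                · exact Or.inr ⟨h, by simp⟩)
            (by rw [Prod.Lex.lt_iff]; exact Or.inl hq)
            (Or.inr ⟨rfl, rfl, h⟩) (Or.inl ⟨rfl, rfl, hpq⟩)
          simp [UnionRel] at this
        · have := hσ (toLex (q, false)) (toLex (i, true)) (toLex (p, false)) (toLex (j, true))
            (by rw [Prod.Lex.lt_iff]
                rcases hq.lt_or_eq with h | h
                · exact Or.inl h
                · exact Or.inr ⟨h, by simp⟩)
            (by rw [Prod.Lex.lt_iff]; exact Or.inl hp1)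
            (by rw [Prod.Lex.lt_iff]
                rcases hp2.lt_or_eq with h | h
                · exact Or.inl h
                · exact Or.inr ⟨h, by simp⟩)
            (Or.inl ⟨rfl, rfl, sameBlock_symm hpq⟩) (Or.inr ⟨rfl, rfl, h⟩)
          simp [UnionRel] at this
      intro p q hpq
      have := aux p q hpq
      have := aux q p (sameBlock_symm hpq)
      grind
    refine le_of_sameBlock fun i j h => ?_
    rcases le_total i j with hij | hij
    · exact key i j hij h
    · exact sameBlock_symm (key j i hij (sameBlock_symm h))

/-! ## Free cumulants, freeness, distributions -/

section Cumulants

variable {k R A : Type*} [Field k] [CommRing R] [Algebra k R] [Ring A] [Algebra k A]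

theorem card_block_lt {n : ℕ} {π : Part n} (h : Finset.univ ∉ π.parts) {V : Finset (Fin n)}
    (hV : V ∈ π.parts) : V.card < n := by
  have h1 : V ≠ Finset.univ := fun h' => h (h' ▸ hV)
  simpa using (Finset.card_lt_univ_of_notMem (s := V)
    (x := (by simpa [Finset.eq_univ_iff_forall] using h1 : ∃ x, x ∉ V).choose)
    (by simpa [Finset.eq_univ_iff_forall] using h1 : ∃ x, x ∉ V).choose_spec)

/-- The free cumulants `κ_n(x₁, …, x_n)`, `n ≥ 1`, of the functional `φ`, by recursion from the
moment-cumulant formula `φ(x₁ ⋯ x_n) = ∑_{π ∈ NC(n)} ∏_{V ∈ π} κ_V[x₁, …, x_n]`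
(see `moment_cumulant`): the sum runs over the `π ≠ 1_n`, that is, those for which `[n]` is not
a block. The tuple belonging to a block `V = (v₁ < ⋯ < v_m)` is `(x_{v₁}, …, x_{v_m})`. -/
def cumulant (φ : A →ₗ[k] R) (n : ℕ) (x : Fin n → A) : R :=
  φ (List.ofFn x).prod -
    ∑ π ∈ ((NC n).filter fun π => Finset.univ ∉ π.parts).attach,
      ∏ V ∈ π.1.parts.attach, cumulant φ V.1.card fun i => x (V.1.orderEmbOfFin rfl i)
termination_by n
decreasing_by exact card_block_lt (Finset.mem_filter.1 π.2).2 V.2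

/-- The subsets `M i` of `A` are combinatorially free: their mixed cumulants vanish. -/
def CombFree {ι : Type*} (φ : A →ₗ[k] R) (M : ι → Set A) : Prop :=
  ∀ (m : ℕ) (i : Fin m → ι) (x : Fin m → A), (∀ j, x j ∈ M (i j)) →
    (∃ s t, i s ≠ i t) → cumulant φ m x = 0

/-- The `R`-valued distribution `μ_a : k[z] → R`, `zⁿ ↦ φ(aⁿ)`, of the random variable `a`. -/
def distribution (φ : A →ₗ[k] R) (a : A) : Polynomial k →ₗ[k] R :=
  φ ∘ₗ (Polynomial.aeval a).toLinearMap

end Cumulants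

/-! ## Series without constant term and boxed convolution -/

section Series

variable {R : Type*} [CommRing R]

variable (R) in
/-- The additive group `𝔐¹(R) = z R⟦z⟧` of power series without constant term. -/
abbrev SeriesM : Ideal R⟦X⟧ := RingHom.ker (PowerSeries.constantCoeff (R := R))

variable (R) in
/-- `𝔊¹₊(R)`: the series `z + a₂ z² + a₃ z³ + ⋯`. -/
abbrev SeriesG : Type _ := {f : SeriesM R // PowerSeries.coeff 1 f.1 = 1}

/-- The series `∑_{n ≥ 1} c_n zⁿ`. -/
def SeriesM.mk (c : ℕ → R) : SeriesM R :=
  ⟨PowerSeries.mk fun n => if n = 0 then 0 else c n, by simp [RingHom.mem_ker]⟩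

theorem SeriesM.coeff_zero (f : SeriesM R) : PowerSeries.coeff 0 f.1 = 0 := by
  have h := RingHom.mem_ker.1 f.2
  rwa [PowerSeries.coeff_zero_eq_constantCoeff_apply]

theorem SeriesM.coeff_mk (c : ℕ → R) {n : ℕ} (hn : n ≠ 0) :
    PowerSeries.coeff n (SeriesM.mk c).1 = c n := by
  simp [SeriesM.mk, hn]

/-- The boxed convolution `f ⊠ g`: its `n`-th coefficient is
`∑_{π ∈ NC(n)} ∏_{V ∈ π} f_{|V|} ∏_{W ∈ K(π)} g_{|W|}`. -/
def boxConv (f g : SeriesM R) : SeriesM R :=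
  SeriesM.mk fun n => ∑ π ∈ NC n,
    (∏ V ∈ π.parts, PowerSeries.coeff V.card f.1) *
      ∏ W ∈ (kreweras π).parts, PowerSeries.coeff W.card g.1

variable (R) in
/-- `Zeta₁ = z + z² + z³ + ⋯`. -/
def zeta : SeriesM R := SeriesM.mk fun _ => 1

/-- The one-block partition `1_n` is unique. -/
theorem eq_of_univ_mem {n : ℕ} {π σ : Part n} (hπ : Finset.univ ∈ π.parts)
    (hσ : Finset.univ ∈ σ.parts) : π = σ := by
  have h : ∀ (τ τ' : Part n), Finset.univ ∈ τ'.parts → τ ≤ τ' := fun τ τ' h' =>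
    fun V _ => ⟨Finset.univ, h', Finset.subset_univ V⟩
  exact le_antisymm (h _ _ hσ) (h _ _ hπ)

theorem exists_univ_mem {n : ℕ} (hn : n ≠ 0) :
    ∃ π : Part n, π ∈ NC n ∧ Finset.univ ∈ π.parts := by
  have : NeZero n := ⟨hn⟩
  have h0 : (Finset.univ : Finset (Fin n)) ≠ ⊥ := Finset.univ_nonempty.ne_empty
  refine ⟨Finpartition.indiscrete h0, ?_, by simp⟩
  simp [NC, IsNonCrossing, NonCrossingRel, SameBlock]

theorem parts_of_univ_mem {n : ℕ} (hn : n ≠ 0) {π : Part n} (hπ : Finset.univ ∈ π.parts) :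
    π.parts = {Finset.univ} := by
  have : NeZero n := ⟨hn⟩
  have h0 : (Finset.univ : Finset (Fin n)) ≠ ⊥ := Finset.univ_nonempty.ne_empty
  rw [eq_of_univ_mem hπ (σ := Finpartition.indiscrete h0) (by simp)]
  simp

theorem kreweras_of_univ_mem {n : ℕ} {π : Part n} (hπ : Finset.univ ∈ π.parts) :
    kreweras π = ⊥ := by
  refine le_antisymm (le_of_sameBlock fun i j h => ?_) bot_le
  rw [sameBlock_kreweras] at h
  have hs : ∀ p q, SameBlock π p q := fun p q => ⟨_, hπ, Finset.mem_univ _, Finset.mem_univ _⟩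
  have hij : i = j := by
    by_contra hne
    rcases lt_or_gt_of_ne hne with hlt | hlt
    · have := h i j (hs i j); grind
    · have := h i j (hs i j); grind
  subst hij
  exact ⟨{i}, by simp, by simp, by simp⟩

theorem sum_NC_eq {n : ℕ} (F : Part n → R) {π₁ : Part n}
    (h₁ : Finset.univ ∈ π₁.parts) (h₁' : π₁ ∈ NC n) :
    ∑ π ∈ NC n, F π = F π₁ + ∑ π ∈ (NC n).filter (fun π => Finset.univ ∉ π.parts), F π := by
  rw [← Finset.sum_filter_add_sum_filter_not (NC n) (fun π => Finset.univ ∈ π.parts)]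
  congr 1
  have : (NC n).filter (fun π => Finset.univ ∈ π.parts) = {π₁} := by
    ext π
    simp only [Finset.mem_filter, Finset.mem_singleton]
    exact ⟨fun h => eq_of_univ_mem h.2 h₁, fun h => by subst h; exact ⟨h₁', h₁⟩⟩
  rw [this, Finset.sum_singleton]

/-- `f ⊠ g` is `f` plus terms of lower order in `f`, if `g = z + ⋯`. -/
theorem coeff_boxConv (f g : SeriesM R) (hg : PowerSeries.coeff 1 g.1 = 1) {n : ℕ} (hn : n ≠ 0) :
    PowerSeries.coeff n (boxConv f g).1 = PowerSeries.coeff n f.1 +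
      ∑ π ∈ (NC n).filter (fun π => Finset.univ ∉ π.parts),
        (∏ V ∈ π.parts, PowerSeries.coeff V.card f.1) *
          ∏ W ∈ (kreweras π).parts, PowerSeries.coeff W.card g.1 := by
  obtain ⟨π₁, h₁', h₁⟩ := exists_univ_mem hn
  rw [boxConv, SeriesM.coeff_mk _ hn, sum_NC_eq _ h₁ h₁', parts_of_univ_mem hn h₁,
    kreweras_of_univ_mem h₁]
  congr 1
  simp [hg]

/-- A unitriangular self-map of `z R⟦z⟧` is bijective. -/
theorem bijective_of_unitriangular (T : SeriesM R → SeriesM R)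
    (hT : ∀ (n : ℕ) (f g : SeriesM R),
      (∀ m < n, PowerSeries.coeff m f.1 = PowerSeries.coeff m g.1) →
      PowerSeries.coeff n (T f).1 - PowerSeries.coeff n f.1 =
        PowerSeries.coeff n (T g).1 - PowerSeries.coeff n g.1) :
    Function.Bijective T := by
  constructor
  · intro f g hfg
    apply Subtype.ext
    ext n
    induction n using Nat.strong_induction_on with
    | _ n ih =>
      have := hT n f g ih
      rw [hfg] at this
      exact sub_right_injective this
  · intro t
    let c : ℕ → R := Nat.strongRec fun n ih =>
      PowerSeries.coeff n t.1 -
        PowerSeries.coeff n (T (SeriesM.mk fun m => if h : m < n then ih m h else 0)).1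
    have hc : ∀ n, c n = PowerSeries.coeff n t.1 -
        PowerSeries.coeff n (T (SeriesM.mk fun m => if m < n then c m else 0)).1 := by
      intro n
      have : c n = _ := Nat.strongRec_eq _ n
      rw [this]
      rfl
    refine ⟨SeriesM.mk c, ?_⟩
    apply Subtype.ext
    ext n
    rcases eq_or_ne n 0 with rfl | hn
    · rw [SeriesM.coeff_zero, SeriesM.coeff_zero]
    · have h := hT n (SeriesM.mk c) (SeriesM.mk fun m => if m < n then c m else 0) (by
        intro m hm
        rcases eq_or_ne m 0 with rfl | hm0
        · rw [SeriesM.coeff_zero, SeriesM.coeff_zero]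
        · rw [SeriesM.coeff_mk _ hm0, SeriesM.coeff_mk _ hm0, if_pos hm])
      rw [SeriesM.coeff_mk _ hn, SeriesM.coeff_mk _ hn, if_neg (lt_irrefl n), sub_zero] at h
      have h' := hc n
      rw [← h] at h'
      linear_combination h'

theorem boxConv_bijective (g : SeriesM R) (hg : PowerSeries.coeff 1 g.1 = 1) :
    Function.Bijective fun f => boxConv f g := by
  refine bijective_of_unitriangular _ fun n f f' h => ?_
  rcases eq_or_ne n 0 with rfl | hn
  · simp only [SeriesM.coeff_zero]
  · simp only [coeff_boxConv _ g hg hn, add_sub_cancel_left]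
    refine Finset.sum_congr rfl fun π hπ => ?_
    congr 1
    exact Finset.prod_congr rfl fun V hV =>
      h _ (card_block_lt (Finset.mem_filter.1 hπ).2 hV)

theorem coeff_one_boxConv (f g : SeriesM R) (hg : PowerSeries.coeff 1 g.1 = 1) :
    PowerSeries.coeff 1 (boxConv f g).1 = PowerSeries.coeff 1 f.1 := by
  rw [coeff_boxConv f g hg one_ne_zero, Finset.sum_eq_zero, add_zero]
  intro π hπ
  exfalso
  obtain ⟨V, hV, -⟩ := π.exists_mem (Finset.mem_univ (0 : Fin 1))
  have h1 := card_block_lt (Finset.mem_filter.1 hπ).2 hV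
  have h2 := (π.nonempty_of_mem_parts hV).card_pos
  omega

/-- Right translation `f ↦ f ⊠ g` on `𝔐¹(R)`, a bijection for `g ∈ 𝔊¹₊(R)`. -/
def boxRight (g : SeriesG R) : SeriesM R ≃ SeriesM R :=
  Equiv.ofBijective (fun f => boxConv f g.1) (boxConv_bijective g.1 g.2)

/-- Right translation `f ↦ f ⊠ g` on `𝔊¹₊(R)`. -/
def boxRightG (g : SeriesG R) : SeriesG R ≃ SeriesG R :=
  (boxRight g).subtypeEquiv fun f => by
    change _ ↔ PowerSeries.coeff 1 (boxConv f g.1).1 = 1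
    rw [coeff_one_boxConv f g.1 g.2]

variable (R) in
/-- `Zeta₁` as an element of `𝔊¹₊(R)`. -/
def zetaG : SeriesG R := ⟨zeta R, SeriesM.coeff_mk _ one_ne_zero⟩

variable (R) in
/-- The unit `z` of the boxed convolution. -/
def unitG : SeriesG R := ⟨⟨PowerSeries.X, by simp [RingHom.mem_ker]⟩, PowerSeries.coeff_one_X⟩

variable (R) in
/-- `Moeb₁` as an element of `𝔊¹₊(R)`: the unique series with `Moeb₁ ⊠ Zeta₁ = z`, and hence the
`⊠`-inverse of `Zeta₁` (for one variable, `⊠` is commutative). -/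
def moebG : SeriesG R := (boxRightG (zetaG R)).symm (unitG R)

variable (R) in
/-- `Moeb₁`, the inverse of `Zeta₁` with respect to `⊠`. -/
def moeb : SeriesM R := (moebG R).1

theorem moeb_boxConv_zeta : boxConv (moeb R) (zeta R) = (unitG R).1 :=
  congrArg Subtype.val ((boxRightG (zetaG R)).apply_symm_apply (unitG R))

/-- `f ⊞_V g = (f ⊠ Moeb₁ + g ⊠ Moeb₁) ⊠ Zeta₁`. -/
def boxPlusV (f g : SeriesM R) : SeriesM R :=
  boxConv (boxConv f (moeb R) + boxConv g (moeb R)) (zeta R)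

/-- `f ⊠_V g = f ⊠ Moeb₁ ⊠ g`. -/
def boxTimesV (f g : SeriesM R) : SeriesM R :=
  boxConv (boxConv f (moeb R)) g

end Series

section Moments

variable {k R A : Type*} [Field k] [CommRing R] [Algebra k R] [Ring A] [Algebra k A]

/-- The moment-cumulant formula. -/
theorem moment_cumulant (φ : A →ₗ[k] R) {n : ℕ} (hn : n ≠ 0) (x : Fin n → A) :
    φ (List.ofFn x).prod = ∑ π ∈ NC n, ∏ V ∈ π.parts,
      cumulant φ V.card fun i => x (V.orderEmbOfFin rfl i) := by
  obtain ⟨π₁, h₁', h₁⟩ := exists_univ_mem hn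
  rw [sum_NC_eq _ h₁ h₁', parts_of_univ_mem hn h₁, Finset.prod_singleton]
  have hx : ∀ (m : ℕ) (hm : (Finset.univ : Finset (Fin n)).card = m) (h : m = n),
      cumulant φ m (fun i => x ((Finset.univ : Finset (Fin n)).orderEmbOfFin hm i)) =
        cumulant φ n x := by
    rintro m hm rfl
    congr 1
    funext i
    congr 1
    have := Finset.orderEmbOfFin_unique hm (f := id) (fun _ => Finset.mem_univ _) strictMono_id
    exact (congrFun this i).symm
  rw [hx _ rfl (by simp), cumulant]
  rw [← Finset.sum_coe_sort ((NC n).filter fun π => Finset.univ ∉ π.parts), Finset.univ_eq_attach,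
    sub_add, sub_eq_self.2]
  rw [sub_eq_zero]
  refine Finset.sum_congr rfl fun π _ => ?_
  exact Finset.prod_attach π.1.parts fun V =>
    cumulant φ V.card fun i => x (V.orderEmbOfFin rfl i)

/-- The element of `𝔐¹(R)` that corresponds to a functional `k[z] → R`. -/
def functionalSeries (μ : Polynomial k →ₗ[k] R) : SeriesM R :=
  SeriesM.mk fun n => μ (Polynomial.X ^ n)

/-- The distribution `μ_a` as an element of `𝔐¹(R)`, i.e. the moment series
`∑_{n ≥ 1} φ(aⁿ) zⁿ`. -/
def mu (φ : A →ₗ[k] R) (a : A) : SeriesM R := functionalSeries (distribution φ a)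

theorem coeff_one_mu (φ : A →ₗ[k] R) (a : A) : PowerSeries.coeff 1 (mu φ a).1 = φ a := by
  rw [mu, functionalSeries, SeriesM.coeff_mk _ one_ne_zero]
  simp [distribution]

/-- If `φ(a) = 1`, then `μ_a` lies in `𝔊¹₊(R)`. -/
def muG (φ : A →ₗ[k] R) (a : A) (ha : φ a = 1) : SeriesG R :=
  ⟨mu φ a, (coeff_one_mu φ a).trans ha⟩

end Moments

/-! ## Logarithm and exponential -/

section Log

variable {R : Type*} [CommRing R]

/-- The inverse of `f ∈ 𝔊¹₊(R)` with respect to composition of power series. -/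
def compInv (f : SeriesG R) : R⟦X⟧ :=
  PowerSeries.substInvOfIsUnit f.1.1 (by rw [f.2]; exact isUnit_one)

/-- The transform `𝓕(f) = f⁻¹(z) / z`. -/
def transF (f : SeriesG R) : R⟦X⟧ :=
  PowerSeries.mk fun n => PowerSeries.coeff (n + 1) (compInv f)

/-- `LOG(f) = d/dz log 𝓕(f)`, where the series `∑_{n ≥ 0} c_n zⁿ` in `R⟦z⟧` is identified with
the element `∑_{n ≥ 1} c_{n-1} zⁿ` of `𝔐¹(R)`, that is, with the sequence of its coefficients. -/
def LOG [Algebra ℚ R] (f : SeriesG R) : SeriesM R :=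
  ⟨PowerSeries.X * PowerSeries.derivative R (PowerSeries.logOf (transF f)), by
    simp [RingHom.mem_ker]⟩

theorem X_mul_transF (f : SeriesG R) : PowerSeries.X * transF f = compInv f := by
  ext n
  rcases n with _ | n
  · simp [compInv]
  · simp [transF, PowerSeries.coeff_succ_X_mul]

theorem constantCoeff_transF (f : SeriesG R) : PowerSeries.constantCoeff (transF f) = 1 := by
  have hu : IsUnit (PowerSeries.coeff 1 f.1.1) := by rw [f.2]; exact isUnit_one
  have h : (hu.unit : R) = 1 := by rw [IsUnit.unit_spec, f.2]
  have h' : hu.unit = 1 := Units.ext h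
  rw [← PowerSeries.coeff_zero_eq_constantCoeff_apply, transF, PowerSeries.coeff_mk, zero_add,
    compInv, PowerSeries.coeff_one_substInvOfIsUnit, h']
  simp

theorem hasSubst_of_mem (f : SeriesM R) : PowerSeries.HasSubst f.1 :=
  PowerSeries.HasSubst.of_constantCoeff_zero' f.2

theorem hasSubst_compInv (f : SeriesG R) : PowerSeries.HasSubst (compInv f) :=
  PowerSeries.HasSubst.of_constantCoeff_zero' (by simp [compInv])

theorem subst_compInv_right (f : SeriesG R) :
    PowerSeries.subst (compInv f) f.1.1 = PowerSeries.X := by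
  exact PowerSeries.subst_substInvOfIsUnit_right _ f.1.2 _

theorem subst_compInv_left (f : SeriesG R) :
    PowerSeries.subst f.1.1 (compInv f) = PowerSeries.X :=
  PowerSeries.subst_substInvOfIsUnit_left _ f.1.2 _

theorem compInv_injective : Function.Injective (compInv (R := R)) := by
  intro f g h
  apply Subtype.ext
  apply Subtype.ext
  have h1 := PowerSeries.subst_comp_subst_apply (hasSubst_compInv f) (hasSubst_of_mem g.1) f.1.1
  rw [subst_compInv_right, h, subst_compInv_left, PowerSeries.subst_X (hasSubst_of_mem g.1),
    PowerSeries.X_subst] at h1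
  exact h1.symm

theorem transF_injective : Function.Injective (transF (R := R)) := fun f g h =>
  compInv_injective (by rw [← X_mul_transF, ← X_mul_transF, h])

theorem transF_surjective (u : R⟦X⟧) (hu : PowerSeries.constantCoeff u = 1) :
    ∃ f : SeriesG R, transF f = u := by
  let g : SeriesG R := ⟨⟨PowerSeries.X * u, by simp [RingHom.mem_ker]⟩, by
    simpa [PowerSeries.coeff_succ_X_mul] using
      (PowerSeries.coeff_succ_X_mul 0 u).trans
        (by rw [PowerSeries.coeff_zero_eq_constantCoeff_apply, hu])⟩
  let f : SeriesG R := ⟨⟨compInv g, by simp [RingHom.mem_ker, compInv]⟩, by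
    change PowerSeries.coeff (0 + 1) (compInv g) = 1
    rw [← X_mul_transF, PowerSeries.coeff_succ_X_mul,
      PowerSeries.coeff_zero_eq_constantCoeff_apply, constantCoeff_transF]⟩
  refine ⟨f, ?_⟩
  have h1 := PowerSeries.subst_comp_subst_apply (hasSubst_of_mem f.1) (hasSubst_compInv f) g.1.1
  have h2 : PowerSeries.subst f.1.1 g.1.1 = PowerSeries.X := subst_compInv_right g
  rw [h2, subst_compInv_right f, PowerSeries.subst_X (hasSubst_compInv f),
    PowerSeries.X_subst] at h1
  have h3 : PowerSeries.X * transF f = PowerSeries.X * u := by rw [X_mul_transF, h1]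
  exact PowerSeries.X_mul_cancel h3

variable [Algebra ℚ R]

theorem derivative_logOf_mul (u : R⟦X⟧) (hu : PowerSeries.constantCoeff u = 1) :
    PowerSeries.derivative R (PowerSeries.logOf u) * u = PowerSeries.derivative R u := by
  have hs : PowerSeries.HasSubst (u - 1) :=
    PowerSeries.HasSubst.of_constantCoeff_zero' (by simp [hu])
  have h1 : PowerSeries.derivative R (PowerSeries.log R) * (1 + PowerSeries.X) = 1 := by
    rw [PowerSeries.deriv_log]
    ext n
    rcases n with _ | n
    · simp [mul_add]
    · rw [mul_add, mul_one, map_add, PowerSeries.coeff_succ_mul_X]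
      simp [pow_succ, PowerSeries.coeff_one]
  have h2 := congrArg (PowerSeries.subst (u - 1)) h1
  rw [← PowerSeries.coe_substAlgHom hs, map_mul, map_add, map_one,
    PowerSeries.substAlgHom_X, PowerSeries.coe_substAlgHom hs, add_sub_cancel] at h2
  rw [PowerSeries.logOf_eq, PowerSeries.derivative_subst hs, map_sub,
    PowerSeries.derivative_one, sub_zero]
  linear_combination (PowerSeries.derivative R u) * h2

theorem eq_of_logDeriv {g u v : R⟦X⟧} (hu : PowerSeries.constantCoeff u = 1)
    (hv : PowerSeries.constantCoeff v = 1) (hu' : g * u = PowerSeries.derivative R u)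
    (hv' : g * v = PowerSeries.derivative R v) : u = v := by
  ext n
  induction n using Nat.strong_induction_on with
  | _ n ih =>
    rcases n with _ | n
    · simp [hu, hv]
    · have h1 := congrArg (PowerSeries.coeff n) hu'
      have h2 := congrArg (PowerSeries.coeff n) hv'
      rw [PowerSeries.coeff_derivative, PowerSeries.coeff_mul] at h1 h2
      have h3 : PowerSeries.coeff (n + 1) u * ((n : R) + 1) =
          PowerSeries.coeff (n + 1) v * ((n : R) + 1) := by
        rw [← h1, ← h2]
        refine Finset.sum_congr rfl fun p hp => ?_
        rw [ih p.2 (by have := Finset.HasAntidiagonal.mem_antidiagonal.1 hp; omega)]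
      have hun : IsUnit ((n : R) + 1) := by
        have := (IsUnit.mk0 ((n : ℚ) + 1) (by positivity)).map (algebraMap ℚ R)
        simpa using this
      exact hun.mul_right_cancel h3

theorem exists_logDeriv (g : R⟦X⟧) :
    ∃ u : R⟦X⟧, PowerSeries.constantCoeff u = 1 ∧ g * u = PowerSeries.derivative R u := by
  let h : R⟦X⟧ := PowerSeries.mk fun n =>
    if n = 0 then 0 else algebraMap ℚ R (1 / (n : ℚ)) * PowerSeries.coeff (n - 1) g
  have h0 : PowerSeries.constantCoeff h = 0 := by
    rw [← PowerSeries.coeff_zero_eq_constantCoeff_apply, PowerSeries.coeff_mk, if_pos rfl]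
  have hd : PowerSeries.derivative R h = g := by
    ext n
    rw [PowerSeries.coeff_derivative, PowerSeries.coeff_mk, if_neg n.succ_ne_zero]
    have : algebraMap ℚ R (1 / ((n + 1 : ℕ) : ℚ)) * ((n : R) + 1) = 1 := by
      have h2 : ((n : R) + 1) = algebraMap ℚ R ((n : ℚ) + 1) := by simp
      rw [h2, ← map_mul]
      have h3 : (1 / ((n + 1 : ℕ) : ℚ)) * ((n : ℚ) + 1) = 1 := by
        push_cast
        field_simp
      rw [h3, map_one]
    rw [Nat.add_sub_cancel]
    linear_combination (PowerSeries.coeff n g) * this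
  have hs : PowerSeries.HasSubst h := PowerSeries.HasSubst.of_constantCoeff_zero' h0
  refine ⟨PowerSeries.subst h (PowerSeries.exp R), ?_, ?_⟩
  · have h1 : PowerSeries.subst h (PowerSeries.exp R) =
        PowerSeries.subst h (PowerSeries.exp R - 1) + 1 := by
      rw [← PowerSeries.coe_substAlgHom hs, map_sub, map_one, sub_add_cancel]
    have h2 : PowerSeries.constantCoeff (PowerSeries.subst h (PowerSeries.exp R - 1)) = 0 :=
      PowerSeries.constantCoeff_subst_eq_zero h0 _ (by simp)
    rw [h1, map_add, h2, map_one, zero_add]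
  · rw [PowerSeries.derivative_subst hs, PowerSeries.derivative_exp, hd, mul_comm]

theorem LOG_bijective : Function.Bijective (LOG (R := R)) := by
  constructor
  · intro f g hfg
    have h : PowerSeries.derivative R (PowerSeries.logOf (transF f)) =
        PowerSeries.derivative R (PowerSeries.logOf (transF g)) :=
      PowerSeries.X_mul_cancel (congrArg Subtype.val hfg)
    exact transF_injective (eq_of_logDeriv (constantCoeff_transF f) (constantCoeff_transF g)
      (derivative_logOf_mul _ (constantCoeff_transF f))
      (h ▸ derivative_logOf_mul _ (constantCoeff_transF g)))
  · intro t
    obtain ⟨g, hg⟩ := PowerSeries.X_dvd_iff.2 (RingHom.mem_ker.1 t.2)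
    obtain ⟨u, hu, hu'⟩ := exists_logDeriv g
    obtain ⟨f, hf⟩ := transF_surjective u hu
    refine ⟨f, Subtype.ext ?_⟩
    have h1 := derivative_logOf_mul u hu
    have hunit : IsUnit u := PowerSeries.isUnit_iff_constantCoeff.2 (by rw [hu]; exact isUnit_one)
    have h2 : PowerSeries.derivative R (PowerSeries.logOf u) = g :=
      hunit.mul_right_cancel (h1.trans hu'.symm)
    change PowerSeries.X * PowerSeries.derivative R (PowerSeries.logOf (transF f)) = t.1
    rw [hf, h2, hg]

/-- `EXP = LOG⁻¹`. -/
def EXP : SeriesM R ≃ SeriesG R := (Equiv.ofBijective LOG LOG_bijective).symm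

/-- The exponential for moments, `EXP_V(f) = EXP(f ⊠ Moeb₁) ⊠ Zeta₁`. -/
def EXPV : SeriesM R ≃ SeriesG R :=
  ((boxRight (moebG R)).trans EXP).trans (boxRightG (zetaG R))

/-- `LOG_V = EXP_V⁻¹`. -/
def LOGV : SeriesG R ≃ SeriesM R := EXPV.symm

theorem EXPV_apply (f : SeriesM R) :
    (EXPV f : SeriesM R) = boxConv (EXP (boxConv f (moeb R)) : SeriesM R) (zeta R) := rfl

end Log

end FreeProb

end

open scoped PowerSeries

noncomputable section

namespace FreeProb

open Finset

/-! The transform `𝓕` (`transF`) turns `⊠` on `𝔊¹₊(R)` into multiplication of power series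
(`transF_boxRightG`). Hence `LOG`, a logarithmic derivative, turns `⊠` into addition, and `EXP`
turns addition into `⊠`.

Multiplicativity comes from cutting a non-crossing partition at the smallest point `m` of the block
of its last point. What lies left of `m` is a partition `τ`; what lies right of `m` is a partition
`ρ` whose last block has been enlarged by `m`. The last block of the Kreweras complement is that of
`τ` enlarged by the last point, and all other complement blocks come from `τ` and `ρ` with unchanged
sizes. For the generating series this gives `P = z·(g/z)(Q)`, `Q = z·(f/z)(P)` and `h = f ⊠ g = f(P)
= g(Q)`, so `P·Q = z·h`. Since `P = f⁻¹(h)` and `Q = g⁻¹(h)`, this says `f⁻¹·g⁻¹ = z·h⁻¹`, which is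
`𝓕(f)·𝓕(g) = 𝓕(h)`.

As `𝓕` is injective with `𝓕(Zeta₁) = 1/(1+z)` and `𝓕(Moeb₁) = 1+z`, identities for `⊠` on `𝔊¹₊(R)`
become identities between products. The operation `⊞_V` also needs `(h ⊠ Zeta₁) ⊠ Moeb₁ = h` for
every `h` in `𝔐¹(R)`, where `𝓕` is not available; `boxConv_zeta_boxConv_moeb` obtains it from the
functional equations. Claims 1 and 2 follow.

For claim 3 the same cut is applied to the alternating word `abab⋯ab`. By freeness only blocks of
one colour contribute, and the series now satisfy `P·Q = z·h·(1+h)` with `h = μ_{ab}`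
(`transF_altSum`). Hence `𝓕(κ_a)·𝓕(κ_b) = 𝓕(μ_{ab})·(1+z)`. With `μ_a = κ_a ⊠ Zeta₁`
(`mu_eq_boxConv`) this is `μ_{ab} = μ_a ⊠_V μ_b`, and claim 2 translates it into exponentials. -/

/-! ## Non-crossing partitions of intervals of natural numbers -/

/-- `P` is the set of blocks of a non-crossing partition of the interval `[i, j)`. -/
structure IsNCI (i j : ℕ) (P : Finset (Finset ℕ)) : Prop where
  nonempty : ∀ V ∈ P, V.Nonempty
  subset : ∀ V ∈ P, ∀ x ∈ V, i ≤ x ∧ x < j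
  cover : ∀ x, i ≤ x → x < j → ∃ V ∈ P, x ∈ V
  eq_of_mem : ∀ V ∈ P, ∀ W ∈ P, ∀ x, x ∈ V → x ∈ W → V = W
  noncrossing : ∀ V ∈ P, ∀ W ∈ P, ∀ p q r s, p < q → q < r → r < s → p ∈ V → q ∈ W →
    r ∈ V → s ∈ W → V = W

open Classical in
/-- The finite set of non-crossing partitions of `[i, j)`. -/
def NCI (i j : ℕ) : Finset (Finset (Finset ℕ)) :=
  (Ico i j).powerset.powerset.filter (IsNCI i j)

theorem mem_NCI {i j : ℕ} {P : Finset (Finset ℕ)} : P ∈ NCI i j ↔ IsNCI i j P := by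
  classical
  simp only [NCI, mem_filter, mem_powerset, and_iff_right_iff_imp]
  intro h V hV
  simp only [mem_powerset]
  intro x hx
  simpa using h.subset V hV x hx

/-- The block of `P` that contains `x` (empty, if there is none). -/
def blk (P : Finset (Finset ℕ)) (x : ℕ) : Finset ℕ := (P.filter (x ∈ ·)).sup id

theorem mem_blk {P : Finset (Finset ℕ)} {x y : ℕ} : y ∈ blk P x ↔ ∃ V ∈ P, x ∈ V ∧ y ∈ V := by
  simp [blk, mem_sup, and_assoc]

theorem IsNCI.blk_eq {i j : ℕ} {P : Finset (Finset ℕ)} (h : IsNCI i j P) {x : ℕ} {V : Finset ℕ}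
    (hV : V ∈ P) (hx : x ∈ V) : blk P x = V := by
  ext y
  rw [mem_blk]
  exact ⟨fun ⟨W, hW, h1, h2⟩ => h.eq_of_mem W hW V hV x h1 hx ▸ h2, fun hy => ⟨V, hV, hx, hy⟩⟩

theorem IsNCI.blk_mem {i j : ℕ} {P : Finset (Finset ℕ)} (h : IsNCI i j P) {x : ℕ}
    (h1 : i ≤ x) (h2 : x < j) : blk P x ∈ P ∧ x ∈ blk P x := by
  obtain ⟨V, hV, hx⟩ := h.cover x h1 h2
  rw [h.blk_eq hV hx]
  exact ⟨hV, hx⟩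

theorem isNCI_empty_iff {i : ℕ} {P : Finset (Finset ℕ)} : IsNCI i i P ↔ P = ∅ := by
  constructor
  · intro h
    refine eq_empty_of_forall_notMem fun V hV => ?_
    obtain ⟨x, hx⟩ := h.nonempty V hV
    have := h.subset V hV x hx
    omega
  · rintro rfl
    constructor <;> simp

theorem NCI_self (i : ℕ) : NCI i i = {∅} := by
  ext P
  rw [mem_NCI, isNCI_empty_iff, mem_singleton]

/-- The union of `τ` with the partition that arises from `ρ` when `m` is added to the block
of `j - 1`. -/
def node (m j : ℕ) (τ ρ : Finset (Finset ℕ)) : Finset (Finset ℕ) :=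
  τ ∪ insert (insert m (blk ρ (j - 1))) (ρ.erase (blk ρ (j - 1)))

/-- The part of `P` to the left of `m`. -/
def leftPart (m : ℕ) (P : Finset (Finset ℕ)) : Finset (Finset ℕ) := P.filter fun V => ∀ x ∈ V, x < m

/-- The part of `P` to the right of `m`. -/
def rightPart (m : ℕ) (P : Finset (Finset ℕ)) : Finset (Finset ℕ) :=
  (P.image (·.erase m)).filter fun V => V.Nonempty ∧ ∀ x ∈ V, m < x

theorem mem_node {m j : ℕ} {τ ρ : Finset (Finset ℕ)} {V : Finset ℕ} : V ∈ node m j τ ρ ↔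
    V ∈ τ ∨ V = insert m (blk ρ (j - 1)) ∨ (V ∈ ρ ∧ V ≠ blk ρ (j - 1)) := by
  simp only [node, mem_union, mem_insert, mem_erase, ne_eq]
  tauto

theorem mem_leftPart {m : ℕ} {P : Finset (Finset ℕ)} {V : Finset ℕ} :
    V ∈ leftPart m P ↔ V ∈ P ∧ ∀ x ∈ V, x < m := by
  simp [leftPart]

theorem mem_rightPart {m : ℕ} {P : Finset (Finset ℕ)} {V : Finset ℕ} :
    V ∈ rightPart m P ↔ (∃ U ∈ P, U.erase m = V) ∧ V.Nonempty ∧ ∀ x ∈ V, m < x := by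
  simp [rightPart]

/-- Either `[m + 1, j)` is empty, or the block of `j - 1` is a block of `ρ`. -/
theorem IsNCI.last_cases {i j : ℕ} {P : Finset (Finset ℕ)} (h : IsNCI i j P) (hij : i ≤ j) :
    (i = j ∧ P = ∅ ∧ blk P (j - 1) = ∅) ∨
      (i < j ∧ blk P (j - 1) ∈ P ∧ j - 1 ∈ blk P (j - 1)) := by
  rcases hij.eq_or_lt with rfl | hlt
  · have := isNCI_empty_iff.1 h
    exact Or.inl ⟨rfl, this, by simp [this, blk]⟩
  · exact Or.inr ⟨hlt, h.blk_mem (by omega) (by omega)⟩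

theorem IsNCI.isNCI_node {i m j : ℕ} {τ ρ : Finset (Finset ℕ)} (hτ : IsNCI i m τ)
    (hρ : IsNCI (m + 1) j ρ) (him : i ≤ m) (hmj : m < j) : IsNCI i j (node m j τ ρ) := by
  have hc := hρ.last_cases (by omega)
  have hsub : ∀ x ∈ blk ρ (j - 1), m < x ∧ x < j := by
    intro x hx
    obtain ⟨V, hV, -, h2⟩ := mem_blk.1 hx
    have := hρ.subset V hV x h2
    omega
  constructor
  · intro V hV
    rcases mem_node.1 hV with h | rfl | ⟨h, -⟩
    · exact hτ.nonempty V h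
    · simp
    · exact hρ.nonempty V h
  · intro V hV x hx
    rcases mem_node.1 hV with h | rfl | ⟨h, -⟩
    · have := hτ.subset V h x hx; omega
    · rcases mem_insert.1 hx with rfl | hx
      · omega
      · have := hsub x hx; omega
    · have := hρ.subset V h x hx; omega
  · intro x h1 h2
    rcases lt_trichotomy x m with h | rfl | h
    · obtain ⟨V, hV, hx⟩ := hτ.cover x h1 h
      exact ⟨V, mem_node.2 (Or.inl hV), hx⟩
    · exact ⟨_, mem_node.2 (Or.inr (Or.inl rfl)), by simp⟩
    · obtain ⟨V, hV, hx⟩ := hρ.cover x h h2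
      by_cases hVL : V = blk ρ (j - 1)
      · exact ⟨_, mem_node.2 (Or.inr (Or.inl rfl)), by simp [← hVL, hx]⟩
      · exact ⟨V, mem_node.2 (Or.inr (Or.inr ⟨hV, hVL⟩)), hx⟩
  · intro V hV W hW x hx hx'
    have key : ∀ U ∈ ρ, x ∈ U → x ∈ blk ρ (j - 1) → U = blk ρ (j - 1) := by
      intro U hU h1 h2
      obtain ⟨V, hV, h3, h4⟩ := mem_blk.1 h2
      rw [hρ.blk_eq hV h3]
      exact hρ.eq_of_mem U hU V hV x h1 h4
    have h1 := fun U hU => hτ.subset U hU x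
    have h2 := fun U hU => hρ.subset U hU x
    have h3 := hsub x
    have h4 := hτ.eq_of_mem V
    have h5 := hρ.eq_of_mem V
    rw [mem_node] at hV hW
    grind
  · intro V hV W hW p q r s hpq hqr hrs hp hq hr hs
    have h1 := hτ.subset
    have h2 := hρ.subset
    have h4 := hτ.noncrossing V
    have h5 := hρ.noncrossing V
    have h6 := hρ.noncrossing W
    rw [mem_node] at hV hW
    rcases hV with hV | rfl | ⟨hV, hV'⟩ <;> rcases hW with hW | rfl | ⟨hW, hW'⟩
    · exact h4 hV W hW p q r s hpq hqr hrs hp hq hr hs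
    · grind
    · grind
    · grind
    · rfl
    · exfalso
      -- The point `m` lies left of `q`, so `r` is in the last block of `ρ`. Replacing `p` by the
      -- later point `j - 1` of that block yields a crossing `q < r < s < j - 1` inside `ρ`.
      have hr' : r ∈ blk ρ (j - 1) := by grind
      have hq' := h2 W hW q hq
      have hs' := h2 W hW s hs
      rcases hc with ⟨h, h', h''⟩ | ⟨-, hL, hj⟩
      · simp [h'] at hW
      · have hsj : s < j - 1 := by
          have : s ≠ j - 1 := by
            rintro rfl
            exact hW' (hρ.eq_of_mem _ hW _ hL _ hs hj)
          omega
        exact hW' (h6 hW _ hL q r s (j - 1) hqr hrs hsj hq hr' hs hj)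
    · grind
    · exfalso
      have := h2 V hV p hp
      have hq' : q ∈ blk ρ (j - 1) := by grind
      have hs' : s ∈ blk ρ (j - 1) := by grind
      rcases hc with ⟨h, h', h''⟩ | ⟨-, hL, hj⟩
      · simp [h'] at hV
      · exact hV' (h5 hV _ hL p q r s hpq hqr hrs hp hq' hr hs')
    · exact h5 hV W hW p q r s hpq hqr hrs hp hq hr hs

theorem blk_node {i m j : ℕ} {τ ρ : Finset (Finset ℕ)} (hτ : IsNCI i m τ)
    (hρ : IsNCI (m + 1) j ρ) (him : i ≤ m) (hmj : m < j) :
    blk (node m j τ ρ) (j - 1) = insert m (blk ρ (j - 1)) := by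
  refine (hτ.isNCI_node hρ him hmj).blk_eq (mem_node.2 (Or.inr (Or.inl rfl))) ?_
  rcases hρ.last_cases (by omega) with ⟨h, h', h''⟩ | ⟨-, hL, hj⟩
  · have : j - 1 = m := by omega
    simp [this]
  · simp [hj]

theorem node_erase {i m j : ℕ} {τ ρ : Finset (Finset ℕ)} (hτ : IsNCI i m τ)
    (hρ : IsNCI (m + 1) j ρ) :
    (node m j τ ρ).erase (insert m (blk ρ (j - 1))) = τ ∪ ρ.erase (blk ρ (j - 1)) := by
  ext V
  have h1 := hτ.subset V
  have h2 := hρ.subset V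
  simp only [mem_erase, mem_node, mem_union]
  have : V = insert m (blk ρ (j - 1)) → m ∈ V := by rintro rfl; simp
  grind

theorem disjoint_of_isNCI {i m j : ℕ} {τ ρ : Finset (Finset ℕ)} (hτ : IsNCI i m τ)
    (hρ : IsNCI (m + 1) j ρ) : Disjoint τ ρ := by
  rw [Finset.disjoint_left]
  intro V h1 h2
  obtain ⟨x, hx⟩ := hτ.nonempty V h1
  have := hτ.subset V h1 x hx
  have := hρ.subset V h2 x hx
  omega

theorem leftPart_node {i m j : ℕ} {τ ρ : Finset (Finset ℕ)} (hτ : IsNCI i m τ)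
    (hρ : IsNCI (m + 1) j ρ) : leftPart m (node m j τ ρ) = τ := by
  ext V
  have h1 := hτ.subset V
  have h2 := hρ.subset V
  have h3 := hρ.nonempty V
  rw [mem_leftPart, mem_node]
  have : V = insert m (blk ρ (j - 1)) → m ∈ V := by rintro rfl; simp
  constructor
  · rintro ⟨h | h | ⟨h, -⟩, h'⟩
    · exact h
    · have := h' m (this h); omega
    · obtain ⟨x, hx⟩ := h3 h
      have := h2 h x hx
      have := h' x hx
      omega
  · exact fun h => ⟨Or.inl h, fun x hx => (h1 h x hx).2⟩

theorem rightPart_node {i m j : ℕ} {τ ρ : Finset (Finset ℕ)} (hτ : IsNCI i m τ)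
    (hρ : IsNCI (m + 1) j ρ) (hmj : m < j) : rightPart m (node m j τ ρ) = ρ := by
  have hm : ∀ V ∈ ρ, m ∉ V := fun V hV h => by have := hρ.subset V hV m h; omega
  have hmL : m ∉ blk ρ (j - 1) := by
    intro h
    obtain ⟨V, hV, -, h2⟩ := mem_blk.1 h
    exact hm V hV h2
  ext V
  rw [mem_rightPart]
  constructor
  · rintro ⟨⟨U, hU, rfl⟩, h1, h2⟩
    rcases mem_node.1 hU with h | rfl | ⟨h, -⟩
    · obtain ⟨x, hx⟩ := h1
      have := hτ.subset U h x (mem_of_mem_erase hx)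
      have := h2 x hx
      omega
    · rw [erase_insert hmL] at h1 ⊢
      rcases hρ.last_cases (by omega) with ⟨-, -, h''⟩ | ⟨-, hL, hj⟩
      · simp [h''] at h1
      · exact hL
    · rwa [erase_eq_of_notMem (hm U h)]
  · intro hV
    refine ⟨?_, hρ.nonempty V hV, fun x hx => (hρ.subset V hV x hx).1⟩
    by_cases hVL : V = blk ρ (j - 1)
    · exact ⟨_, mem_node.2 (Or.inr (Or.inl rfl)), by rw [erase_insert hmL, hVL]⟩
    · exact ⟨V, mem_node.2 (Or.inr (Or.inr ⟨hV, hVL⟩)), erase_eq_of_notMem (hm V hV)⟩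

/-- The cut point `m` is the minimum of the block `B` of `j - 1`. Any other block with a point `y <
m` and a point `x > m` would cross `B` along `y < m < x < j - 1`, so each of them lies on one side
of `m`. If `m = j - 1`, the right part is empty and `blk` takes its default value `∅`. -/
theorem IsNCI.exists_node {i j : ℕ} {P : Finset (Finset ℕ)} (h : IsNCI i j P) (hij : i < j) :
    ∃ m τ ρ, i ≤ m ∧ m < j ∧ IsNCI i m τ ∧ IsNCI (m + 1) j ρ ∧ node m j τ ρ = P := by
  obtain ⟨hL, hj⟩ := h.blk_mem (x := j - 1) (by omega) (by omega)
  set B := blk P (j - 1) with hB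
  obtain ⟨m, hmB, hmin⟩ : ∃ m ∈ B, ∀ x ∈ B, m ≤ x :=
    ⟨B.min' ⟨_, hj⟩, min'_mem _ _, fun x hx => min'_le _ _ hx⟩
  have hm := h.subset B hL m hmB
  have hsplit : ∀ V ∈ P, V ≠ B → (∀ x ∈ V, x < m) ∨ (∀ x ∈ V, m < x) := by
    intro V hV hVB
    by_contra! hcon
    obtain ⟨⟨x, hx, hx'⟩, ⟨y, hy, hy'⟩⟩ := hcon
    have hne : ∀ z ∈ V, z ∉ B := fun z hz hz' => hVB (h.eq_of_mem V hV B hL z hz hz')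
    have h1 : x ≠ m := fun e => hne x hx (e ▸ hmB)
    have h2 : y ≠ m := fun e => hne y hy (e ▸ hmB)
    have h3 : x ≠ j - 1 := fun e => hne x hx (e ▸ hj)
    have := h.subset V hV x hx
    exact hVB (h.noncrossing V hV B hL y m x (j - 1) (by omega) (by omega) (by omega) hy hmB hx hj)
  have hrm : ∀ U ∈ P, (U.erase m).Nonempty → (∀ x ∈ U.erase m, m < x) →
      U = B ∨ (m ∉ U ∧ U.erase m = U) := by
    intro U hU _ _
    by_cases hmU : m ∈ U
    · exact Or.inl (h.eq_of_mem U hU B hL m hmU hmB)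
    · exact Or.inr ⟨hmU, erase_eq_of_notMem hmU⟩
  have hmr : ∀ V, V ∈ rightPart m P ↔
      (V = B.erase m ∧ V.Nonempty) ∨ (V ∈ P ∧ V ≠ B ∧ ∀ x ∈ V, m < x) := by
    intro V
    rw [mem_rightPart]
    constructor
    · rintro ⟨⟨U, hU, rfl⟩, h1, h2⟩
      rcases hrm U hU h1 h2 with rfl | ⟨h3, h4⟩
      · exact Or.inl ⟨rfl, h1⟩
      · rw [h4]
        exact Or.inr ⟨hU, fun e => h3 (e ▸ hmB), fun x hx => h2 x (h4.symm ▸ hx)⟩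
    · rintro (⟨rfl, h1⟩ | ⟨h1, h2, h3⟩)
      · refine ⟨⟨B, hL, rfl⟩, h1, fun x hx => ?_⟩
        have := hmin x (mem_of_mem_erase hx)
        have := ne_of_mem_erase hx
        omega
      · exact ⟨⟨V, h1, erase_eq_of_notMem fun hmV => by have := h3 m hmV; omega⟩,
          h.nonempty V h1, h3⟩
  have hlt : IsNCI i m (leftPart m P) := by
    constructor
    · exact fun V hV => h.nonempty V (mem_leftPart.1 hV).1
    · intro V hV x hx
      rw [mem_leftPart] at hV
      exact ⟨(h.subset V hV.1 x hx).1, hV.2 x hx⟩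
    · intro x h1 h2
      obtain ⟨V, hV, hx⟩ := h.cover x h1 (by omega)
      refine ⟨V, mem_leftPart.2 ⟨hV, ?_⟩, hx⟩
      rcases hsplit V hV (by rintro rfl; have := hmin x hx; omega) with h' | h'
      · exact h'
      · have := h' x hx; omega
    · exact fun V hV W hW => h.eq_of_mem V (mem_leftPart.1 hV).1 W (mem_leftPart.1 hW).1
    · exact fun V hV W hW => h.noncrossing V (mem_leftPart.1 hV).1 W (mem_leftPart.1 hW).1
  have hrt : IsNCI (m + 1) j (rightPart m P) := by
    have hup : ∀ V ∈ rightPart m P, ∃ U ∈ P, V = U.erase m := by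
      intro V hV
      obtain ⟨⟨U, hU, h1⟩, -⟩ := mem_rightPart.1 hV
      exact ⟨U, hU, h1.symm⟩
    constructor
    · exact fun V hV => (mem_rightPart.1 hV).2.1
    · intro V hV x hx
      have h1 := (mem_rightPart.1 hV).2.2 x hx
      obtain ⟨U, hU, rfl⟩ := hup V hV
      have := h.subset U hU x (mem_of_mem_erase hx)
      omega
    · intro x h1 h2
      obtain ⟨V, hV, hx⟩ := h.cover x (by omega) h2
      by_cases hVB : V = B
      · have : x ∈ B.erase m := mem_erase.2 ⟨by omega, hVB ▸ hx⟩
        exact ⟨B.erase m, (hmr _).2 (Or.inl ⟨rfl, x, this⟩), this⟩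
      · refine ⟨V, (hmr _).2 (Or.inr ⟨hV, hVB, ?_⟩), hx⟩
        rcases hsplit V hV hVB with h' | h'
        · have := h' x hx; omega
        · exact h'
    · intro V hV W hW x hx hx'
      obtain ⟨U, hU, rfl⟩ := hup V hV
      obtain ⟨U', hU', rfl⟩ := hup W hW
      rw [h.eq_of_mem U hU U' hU' x (mem_of_mem_erase hx) (mem_of_mem_erase hx')]
    · intro V hV W hW p q r s h1 h2 h3 hp hq hr hs
      obtain ⟨U, hU, rfl⟩ := hup V hV
      obtain ⟨U', hU', rfl⟩ := hup W hW
      rw [h.noncrossing U hU U' hU' p q r s h1 h2 h3 (mem_of_mem_erase hp) (mem_of_mem_erase hq)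
        (mem_of_mem_erase hr) (mem_of_mem_erase hs)]
  have hb : blk (rightPart m P) (j - 1) = B.erase m := by
    by_cases hmj : m = j - 1
    · have hB1 : B.erase m = ∅ := by
        refine eq_empty_of_forall_notMem fun x hx => ?_
        have h1 := hmin x (mem_of_mem_erase hx)
        have h2 := ne_of_mem_erase hx
        have h3 := h.subset B hL x (mem_of_mem_erase hx)
        omega
      rcases hrt.last_cases (by omega) with ⟨-, -, h''⟩ | ⟨h', -⟩
      · rw [h'', hB1]
      · omega
    · have hj' : j - 1 ∈ B.erase m := mem_erase.2 ⟨by omega, hj⟩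
      exact hrt.blk_eq ((hmr _).2 (Or.inl ⟨rfl, _, hj'⟩)) hj'
  refine ⟨m, leftPart m P, rightPart m P, hm.1, hm.2, hlt, hrt, ?_⟩
  ext V
  rw [mem_node, hb, insert_erase hmB, mem_leftPart, hmr]
  constructor
  · rintro (h1 | rfl | ⟨⟨h1, -⟩ | h1, h2⟩)
    · exact h1.1
    · exact hL
    · exact absurd h1 h2
    · exact h1.1
  · intro hV
    by_cases hVB : V = B
    · exact Or.inr (Or.inl hVB)
    · rcases hsplit V hV hVB with h' | h'
      · exact Or.inl ⟨hV, h'⟩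
      · refine Or.inr (Or.inr ⟨Or.inr ⟨hV, hVB, h'⟩, ?_⟩)
        rintro rfl
        obtain ⟨x, hx⟩ := h.nonempty _ hV
        exact hVB (h.eq_of_mem _ hV B hL x hx (mem_of_mem_erase hx))

/-- Both cut points belong to the last block of the same partition, and no point of that block is
smaller than `m`. -/
theorem node_min {i i' m m' j : ℕ} {τ ρ τ' ρ' : Finset (Finset ℕ)} (hτ : IsNCI i m τ)
    (hρ : IsNCI (m + 1) j ρ) (him : i ≤ m) (hmj : m < j) (hτ' : IsNCI i' m' τ')
    (hρ' : IsNCI (m' + 1) j ρ') (him' : i' ≤ m') (hmj' : m' < j)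
    (h : node m j τ ρ = node m' j τ' ρ') : m ≤ m' := by
  have h1 := blk_node hτ hρ him hmj
  rw [h, blk_node hτ' hρ' him' hmj'] at h1
  have h2 : m' ∈ insert m (blk ρ (j - 1)) := h1 ▸ mem_insert_self _ _
  rcases mem_insert.1 h2 with h2 | h2
  · exact h2.ge
  · obtain ⟨V, hV, -, h3⟩ := mem_blk.1 h2
    have := hρ.subset V hV m' h3
    omega

/-- A sum over the non-crossing partitions of `[i, j)`, arranged by the smallest element `m` of the
block of `j - 1`. -/
theorem sum_NCI {R : Type*} [AddCommMonoid R] {i j : ℕ} (hij : i < j)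
    (F : Finset (Finset ℕ) → R) :
    ∑ P ∈ NCI i j, F P =
      ∑ m ∈ Ico i j, ∑ τ ∈ NCI i m, ∑ ρ ∈ NCI (m + 1) j, F (node m j τ ρ) := by
  simp_rw [← sum_product' (s := NCI _ _) (t := NCI _ _)]
  rw [sum_sigma']
  symm
  refine sum_bij (fun x _ => node x.1 j x.2.1 x.2.2) ?_ ?_ ?_ fun _ _ => rfl
  · rintro ⟨m, τ, ρ⟩ hx
    simp only [mem_sigma, mem_Ico, mem_product, mem_NCI] at hx ⊢
    exact hx.2.1.isNCI_node hx.2.2 hx.1.1 hx.1.2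
  · rintro ⟨m, τ, ρ⟩ hx ⟨m', τ', ρ'⟩ hx' h
    simp only [mem_sigma, mem_Ico, mem_product, mem_NCI] at hx hx' h
    -- Injectivity: the cut point is determined as the minimum of the last block, and then
    -- `leftPart` and `rightPart` recover `τ` and `ρ`.
    have h1 := node_min hx.2.1 hx.2.2 hx.1.1 hx.1.2 hx'.2.1 hx'.2.2 hx'.1.1 hx'.1.2 h
    have h2 := node_min hx'.2.1 hx'.2.2 hx'.1.1 hx'.1.2 hx.2.1 hx.2.2 hx.1.1 hx.1.2 h.symm
    obtain rfl : m = m' := le_antisymm h1 h2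
    have h3 := leftPart_node hx.2.1 hx.2.2
    have h4 := rightPart_node hx.2.1 hx.2.2 hx.1.2
    rw [h, leftPart_node hx'.2.1 hx'.2.2] at h3
    rw [h, rightPart_node hx'.2.1 hx'.2.2 hx.1.2] at h4
    rw [h3, h4]
  · intro P hP
    obtain ⟨m, τ, ρ, h1, h2, h3, h4, h5⟩ := (mem_NCI.1 hP).exists_node hij
    exact ⟨⟨m, τ, ρ⟩, by simpa [mem_NCI] using ⟨⟨h1, h2⟩, h3, h4⟩, h5⟩

/-! ## The Kreweras complement on intervals -/

/-- The equivalence relation of the Kreweras complement of `P`. -/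
def Krel (P : Finset (Finset ℕ)) (x y : ℕ) : Prop :=
  ∀ V ∈ P, ∀ p ∈ V, ∀ q ∈ V, ((p ≤ x ↔ p ≤ y) ↔ (q ≤ x ↔ q ≤ y))

theorem Krel.refl (P : Finset (Finset ℕ)) (x : ℕ) : Krel P x x := fun _ _ _ _ _ _ => by simp

theorem Krel.symm {P : Finset (Finset ℕ)} {x y : ℕ} (h : Krel P x y) : Krel P y x :=
  fun V hV p hp q hq => by have := h V hV p hp q hq; tauto

theorem Krel.trans {P : Finset (Finset ℕ)} {x y z : ℕ} (h : Krel P x y) (h' : Krel P y z) :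
    Krel P x z :=
  fun V hV p hp q hq => by have := h V hV p hp q hq; have := h' V hV p hp q hq; tauto

open Classical in
/-- The block of `x` in the Kreweras complement of the partition `P` of `[i, j)`. -/
def Kcls (P : Finset (Finset ℕ)) (i j x : ℕ) : Finset ℕ := (Ico i j).filter (Krel P x)

/-- The Kreweras complement of the partition `P` of `[i, j)`. -/
def Kparts (P : Finset (Finset ℕ)) (i j : ℕ) : Finset (Finset ℕ) := (Ico i j).image (Kcls P i j)

theorem mem_Kcls {P : Finset (Finset ℕ)} {i j x y : ℕ} :
    y ∈ Kcls P i j x ↔ (i ≤ y ∧ y < j) ∧ Krel P x y := by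
  simp [Kcls]

theorem mem_Kparts {P : Finset (Finset ℕ)} {i j : ℕ} {V : Finset ℕ} :
    V ∈ Kparts P i j ↔ ∃ x, (i ≤ x ∧ x < j) ∧ Kcls P i j x = V := by
  simp [Kparts]

theorem Kcls_eq_iff {P : Finset (Finset ℕ)} {i j x y : ℕ} (hy : i ≤ y) (hy' : y < j) :
    Kcls P i j x = Kcls P i j y ↔ Krel P x y := by
  constructor
  · intro h
    exact (mem_Kcls.1 (h ▸ mem_Kcls.2 ⟨⟨hy, hy'⟩, Krel.refl P y⟩ : y ∈ Kcls P i j x)).2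
  · intro h
    ext z
    rw [mem_Kcls, mem_Kcls]
    exact ⟨fun hz => ⟨hz.1, h.symm.trans hz.2⟩, fun hz => ⟨hz.1, h.trans hz.2⟩⟩

/-- The last block of the Kreweras complement (empty, if `[i, j)` is empty). -/
def Klast (P : Finset (Finset ℕ)) (i j : ℕ) : Finset ℕ := Kcls P i j (j - 1)

/-! ### The Kreweras complement of a composed partition -/

section Node

variable {i m j : ℕ} {τ ρ : Finset (Finset ℕ)}

/-- Not being separated is transitive within a block, so the enlarged block only requires each of
its points to be compared with `m`. Two points of the last block of `ρ` are then compared through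
`m`. -/
theorem krel_node {x y : ℕ} : Krel (node m j τ ρ) x y ↔ Krel τ x y ∧ Krel ρ x y ∧
    ∀ q ∈ blk ρ (j - 1), ((m ≤ x ↔ m ≤ y) ↔ (q ≤ x ↔ q ≤ y)) := by
  constructor
  · intro h
    have hL : ∀ q ∈ blk ρ (j - 1), ((m ≤ x ↔ m ≤ y) ↔ (q ≤ x ↔ q ≤ y)) := fun q hq =>
      h _ (mem_node.2 (Or.inr (Or.inl rfl))) m (by simp) q (by simp [hq])
    refine ⟨fun V hV => h V (mem_node.2 (Or.inl hV)), fun V hV p hp q hq => ?_, hL⟩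
    by_cases hVL : V = blk ρ (j - 1)
    · rw [← hL p (hVL ▸ hp), ← hL q (hVL ▸ hq)]
    · exact h V (mem_node.2 (Or.inr (Or.inr ⟨hV, hVL⟩))) p hp q hq
  · rintro ⟨h1, h2, h3⟩ V hV p hp q hq
    rcases mem_node.1 hV with h | rfl | ⟨h, -⟩
    · exact h1 V h p hp q hq
    · have h4 : ∀ q ∈ insert m (blk ρ (j - 1)), ((m ≤ x ↔ m ≤ y) ↔ (q ≤ x ↔ q ≤ y)) := by
        intro q hq
        rcases mem_insert.1 hq with rfl | hq
        · rfl
        · exact h3 q hq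
      rw [← h4 p hp, ← h4 q hq]
    · exact h2 V h p hp q hq

/-- The relabelling of the points of the complement of `ρ` in the complement of `node m j τ ρ`. -/
def shiftLast (m j : ℕ) (x : ℕ) : ℕ := if x = j - 1 then m else x

theorem krel_node_left (hρ : IsNCI (m + 1) j ρ) {x y : ℕ} (hx : x < m) (hy : y < m) :
    Krel (node m j τ ρ) x y ↔ Krel τ x y := by
  have hs := hρ.subset
  rw [krel_node, and_iff_left]
  refine ⟨fun V hV p hp q hq => ?_, fun q hq => ?_⟩
  · have := hs V hV p hp
    have := hs V hV q hq
    grind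
  · obtain ⟨V, hV, -, h⟩ := mem_blk.1 hq
    have := hs V hV q h
    grind

/-- The barred points of `m - 1` and `j - 1` are both to the right of `τ`, so `τ` cannot tell them
apart. All remaining points of the partition lie between `x` and `j - 1`, so they impose no
condition. -/
theorem krel_node_left_last (hτ : IsNCI i m τ) (hρ : IsNCI (m + 1) j ρ) (hmj : m < j)
    {x : ℕ} (hx : x < m) : Krel (node m j τ ρ) x (j - 1) ↔ Krel τ x (m - 1) := by
  have hs := hρ.subset
  have ht := hτ.subset
  have e : Krel τ x (j - 1) ↔ Krel τ x (m - 1) := by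
    refine forall₂_congr fun V hV => forall₂_congr fun p hp => forall₂_congr fun q hq => ?_
    have := ht V hV p hp
    have := ht V hV q hq
    grind
  rw [krel_node, e, and_iff_left]
  refine ⟨fun V hV p hp q hq => ?_, fun q hq => ?_⟩
  · have := hs V hV p hp
    have := hs V hV q hq
    grind
  · obtain ⟨V, hV, -, h⟩ := mem_blk.1 hq
    have := hs V hV q h
    grind

/-- The block containing `m` and `j - 1` separates: `m` lies between the two barred points and `j -
1` does not. -/
theorem not_krel_node_left_right (hρ : IsNCI (m + 1) j ρ) {x y : ℕ} (hx : x < m) (hy : m ≤ y)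
    (hy' : y < j - 1) : ¬ Krel (node m j τ ρ) x y := by
  intro h
  have h1 := (krel_node.1 h).2.2 (j - 1) (hρ.blk_mem (by omega) (by omega)).2
  grind

theorem not_krel_node_right_last (hρ : IsNCI (m + 1) j ρ) {x : ℕ} (hx : m ≤ x)
    (hx' : x < j - 1) : ¬ Krel (node m j τ ρ) x (j - 1) := by
  intro h
  have h1 := (krel_node.1 h).2.2 (j - 1) (hρ.blk_mem (by omega) (by omega)).2
  grind

theorem iff_iff_iff_cancel_right {a b c : Prop} : ((a ↔ c) ↔ (b ↔ c)) ↔ (a ↔ b) := by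
  by_cases c <;> simp [*, not_iff_not]

/-- Seen from `ρ`, the barred points of `j - 1` and `m` both bound `(m, j)` from outside, one on the
right and one on the left. Replacing one by the other negates every comparison with a point of `ρ`
simultaneously, and a simultaneous negation does not affect whether two points of `ρ` are on the
same side. -/
theorem krel_node_right (hτ : IsNCI i m τ) (hρ : IsNCI (m + 1) j ρ) {x y : ℕ}
    (hx : m < x) (hx' : x < j) (hy : m < y) (hy' : y < j) :
    Krel (node m j τ ρ) (shiftLast m j x) (shiftLast m j y) ↔ Krel ρ x y := by
  have hs := hρ.subset
  have ht := hτ.subset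
  obtain ⟨hL, hj⟩ := hρ.blk_mem (x := j - 1) (by omega) (by omega)
  have hσ : ∀ z, m < z → m ≤ shiftLast m j z := by
    intro z hz; unfold shiftLast; split_ifs <;> omega
  have e1 : Krel τ (shiftLast m j x) (shiftLast m j y) := by
    intro V hV p hp q hq
    have := ht V hV p hp
    have := ht V hV q hq
    have := hσ x hx
    have := hσ y hy
    grind
  rw [krel_node, and_iff_right e1]
  have e2 : ∀ p, m < p → p < j → ((p ≤ shiftLast m j x ↔ p ≤ shiftLast m j y) ↔
      ((p ≤ x ↔ p ≤ y) ↔ (x = j - 1 ↔ y = j - 1))) := by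
    intro p h1 h2
    unfold shiftLast
    have : p ≤ j - 1 := by omega
    have : ¬ p ≤ m := by omega
    by_cases h3 : x = j - 1 <;> by_cases h4 : y = j - 1 <;> simp [*]
  have e3 : (m ≤ shiftLast m j x ↔ m ≤ shiftLast m j y) := by simp [hσ x hx, hσ y hy]
  have e4 : ((j - 1 ≤ x ↔ j - 1 ≤ y) ↔ (x = j - 1 ↔ y = j - 1)) := by
    rw [show j - 1 ≤ x ↔ x = j - 1 by omega, show j - 1 ≤ y ↔ y = j - 1 by omega]
  constructor
  · rintro ⟨h1, -⟩ V hV p hp q hq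
    have h2 := h1 V hV p hp q hq
    rwa [e2 p (hs V hV p hp).1 (hs V hV p hp).2, e2 q (hs V hV q hq).1 (hs V hV q hq).2,
      iff_iff_iff_cancel_right] at h2
  · intro h
    constructor
    · intro V hV p hp q hq
      rw [e2 p (hs V hV p hp).1 (hs V hV p hp).2, e2 q (hs V hV q hq).1 (hs V hV q hq).2,
        iff_iff_iff_cancel_right]
      exact h V hV p hp q hq
    -- The extra condition from `m` is the condition for the last block of `ρ`, tested against its
    -- point `j - 1`.
    · intro q hq
      have h5 := h _ hL q hq (j - 1) hj
      rw [e4] at h5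
      rw [e2 q (hs _ hL q hq).1 (hs _ hL q hq).2, iff_true_left e3]
      exact h5

theorem shiftLast_injOn {x y : ℕ} (hx : m < x) (hy : m < y)
    (h : shiftLast m j x = shiftLast m j y) : x = y := by
  unfold shiftLast at h
  grind

theorem Klast_node (hτ : IsNCI i m τ) (hρ : IsNCI (m + 1) j ρ) (him : i ≤ m) (hmj : m < j) :
    Klast (node m j τ ρ) i j = insert (j - 1) (Klast τ i m) := by
  ext y
  rw [Klast, Klast, mem_insert, mem_Kcls, mem_Kcls]
  rcases lt_or_ge y m with h | h
  · have := krel_node_left_last hτ hρ hmj h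
    have h1 : Krel (node m j τ ρ) (j - 1) y ↔ Krel τ (m - 1) y :=
      ⟨fun h => (this.1 h.symm).symm, fun h => (this.2 h.symm).symm⟩
    rw [h1]
    grind
  · rcases lt_or_ge y (j - 1) with h' | h'
    · have := not_krel_node_right_last (τ := τ) hρ h h'
      have : ¬ Krel (node m j τ ρ) (j - 1) y := fun h => this h.symm
      grind
    · have := Krel.refl (node m j τ ρ) y
      have h1 : (i ≤ y ∧ y < j) ↔ y = j - 1 := by omega
      rw [h1]
      grind

/-- The arc from `m` to `j - 1` isolates the barred points in `[m, j - 1)`, which are the relabelled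
points of the complement of `ρ`. Barred points left of `m` keep their classes from `τ`, except for
the class that is joined to `j - 1`. -/
theorem Kparts_node_erase (hτ : IsNCI i m τ) (hρ : IsNCI (m + 1) j ρ) (him : i ≤ m)
    (hmj : m < j) :
    (Kparts (node m j τ ρ) i j).erase (Klast (node m j τ ρ) i j) =
      (Kparts τ i m).erase (Klast τ i m) ∪
        (Kparts ρ (m + 1) j).image (·.image (shiftLast m j)) := by
  have hleft : ∀ x, i ≤ x → x < m → ¬ Krel τ x (m - 1) →
      Kcls (node m j τ ρ) i j x = Kcls τ i m x := by
    intro x h1 h2 h3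
    ext y
    rw [mem_Kcls, mem_Kcls]
    rcases lt_or_ge y m with h | h
    · rw [krel_node_left hρ h2 h]
      grind
    · rcases lt_or_ge y (j - 1) with h' | h'
      · have := not_krel_node_left_right (τ := τ) hρ h2 h h'
        grind
      · have := krel_node_left_last hτ hρ hmj h2
        have : y = j - 1 → ¬ Krel (node m j τ ρ) x y := by rintro rfl; rwa [this]
        grind
  have hright : ∀ x, m < x → x < j →
      Kcls (node m j τ ρ) i j (shiftLast m j x) = (Kcls ρ (m + 1) j x).image (shiftLast m j) := by
    intro x h1 h2
    have hσ : ∀ z, m < z → z < j → m ≤ shiftLast m j z ∧ shiftLast m j z < j - 1 := by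
      intro z hz hz'; unfold shiftLast; split_ifs <;> omega
    have hσx := hσ x h1 h2
    ext y
    rw [mem_Kcls, mem_image]
    constructor
    · rintro ⟨⟨h3, h4⟩, h5⟩
      rcases lt_or_ge y m with h | h
      · exact absurd h5.symm (not_krel_node_left_right hρ h hσx.1 hσx.2)
      · rcases lt_or_ge y (j - 1) with h' | h'
        · obtain ⟨z, hz, hz', rfl⟩ : ∃ z, m < z ∧ z < j ∧ shiftLast m j z = y := by
            rcases h.eq_or_lt with rfl | h
            · exact ⟨j - 1, by omega, by omega, by simp [shiftLast]⟩
            · exact ⟨y, h, h4, by simp [shiftLast]; omega⟩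
          exact ⟨z, mem_Kcls.2 ⟨⟨hz, hz'⟩, (krel_node_right hτ hρ h1 h2 hz hz').1 h5⟩, rfl⟩
        · obtain rfl : y = j - 1 := by omega
          exact absurd h5 (not_krel_node_right_last hρ hσx.1 hσx.2)
    · rintro ⟨z, hz, rfl⟩
      obtain ⟨⟨hz, hz'⟩, h3⟩ := mem_Kcls.1 hz
      have := hσ z (by omega) hz'
      exact ⟨by omega, (krel_node_right hτ hρ h1 h2 (by omega) hz').2 h3⟩
  ext V
  rw [mem_erase, mem_union, mem_erase, mem_Kparts, mem_Kparts, mem_image]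
  constructor
  · rintro ⟨h0, x, ⟨h1, h2⟩, rfl⟩
    rw [Klast, Ne, Kcls_eq_iff (by omega) (by omega)] at h0
    rcases lt_or_ge x m with h | h
    · rw [krel_node_left_last hτ hρ hmj h] at h0
      refine Or.inl ⟨?_, x, ⟨h1, h⟩, (hleft x h1 h h0).symm⟩
      rw [hleft x h1 h h0, Klast, Ne, Kcls_eq_iff (by omega) (by omega)]
      exact h0
    · have hxj : x ≠ j - 1 := by
        rintro rfl
        exact h0 (Krel.refl _ _)
      obtain ⟨z, hz, hz', rfl⟩ : ∃ z, m < z ∧ z < j ∧ shiftLast m j z = x := by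
        rcases h.eq_or_lt with rfl | h
        · exact ⟨j - 1, by omega, by omega, by simp [shiftLast]⟩
        · exact ⟨x, h, h2, by simp [shiftLast]; omega⟩
      exact Or.inr ⟨_, mem_Kparts.2 ⟨z, ⟨hz, hz'⟩, rfl⟩, (hright z hz hz').symm⟩
  · rintro (⟨h0, x, ⟨h1, h2⟩, rfl⟩ | ⟨W, hW, rfl⟩)
    · rw [Klast, Ne, Kcls_eq_iff (by omega) (by omega)] at h0
      rw [← hleft x h1 h2 h0, Klast, Ne, Kcls_eq_iff (by omega) (by omega),
        krel_node_left_last hτ hρ hmj h2]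
      exact ⟨h0, x, ⟨h1, by omega⟩, rfl⟩
    · obtain ⟨z, ⟨hz, hz'⟩, rfl⟩ := mem_Kparts.1 hW
      have hσ : m ≤ shiftLast m j z ∧ shiftLast m j z < j - 1 := by
        unfold shiftLast; split_ifs <;> omega
      rw [← hright z (by omega) hz', Klast, Ne, Kcls_eq_iff (by omega) (by omega)]
      exact ⟨not_krel_node_right_last hρ hσ.1 hσ.2, _, ⟨by omega, by omega⟩, rfl⟩

end Node

/-! ### Block sizes and products under composition -/

section Weights

variable {R : Type*} [CommRing R] {i m j : ℕ} {τ ρ : Finset (Finset ℕ)}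

theorem Klast_node_card (hτ : IsNCI i m τ) (hρ : IsNCI (m + 1) j ρ) (him : i ≤ m) (hmj : m < j) :
    (Klast (node m j τ ρ) i j).card = (Klast τ i m).card + 1 := by
  rw [Klast_node hτ hρ him hmj, card_insert_of_notMem]
  intro h
  have := (mem_Kcls.1 h).1
  omega

theorem prod_Kparts_node_erase (hτ : IsNCI i m τ) (hρ : IsNCI (m + 1) j ρ) (him : i ≤ m)
    (hmj : m < j) (g : ℕ → R) :
    ∏ W ∈ (Kparts (node m j τ ρ) i j).erase (Klast (node m j τ ρ) i j), g W.card =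
      (∏ W ∈ (Kparts τ i m).erase (Klast τ i m), g W.card) *
        ∏ W ∈ Kparts ρ (m + 1) j, g W.card := by
  have hsub : ∀ W ∈ Kparts ρ (m + 1) j, ∀ x ∈ W, m < x ∧ x < j := by
    intro W hW x hx
    obtain ⟨z, -, rfl⟩ := mem_Kparts.1 hW
    have := (mem_Kcls.1 hx).1
    omega
  have hinj : ∀ W ∈ Kparts ρ (m + 1) j, Set.InjOn (shiftLast m j) W := fun W hW x hx y hy h =>
    shiftLast_injOn (hsub W hW x hx).1 (hsub W hW y hy).1 h
  rw [Kparts_node_erase hτ hρ him hmj, prod_union, prod_image]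
  · congr 1
    exact prod_congr rfl fun W hW => by rw [card_image_of_injOn (hinj W hW)]
  · intro W hW W' hW' h
    have key : ∀ U ∈ Kparts ρ (m + 1) j, ∀ U' ∈ Kparts ρ (m + 1) j,
        U.image (shiftLast m j) = U'.image (shiftLast m j) → U ⊆ U' := by
      intro U hU U' hU' h x hx
      obtain ⟨y, hy, hxy⟩ := mem_image.1 (h ▸ mem_image_of_mem _ hx)
      rwa [← shiftLast_injOn (hsub _ hU' y hy).1 (hsub _ hU x hx).1 hxy]
    exact (key W hW W' hW' h).antisymm (key W' hW' W hW h.symm)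
  · rw [Finset.disjoint_left]
    intro W h1 h2
    obtain ⟨z, hz, rfl⟩ := mem_Kparts.1 (mem_of_mem_erase h1)
    obtain ⟨U, hU, h3⟩ := mem_image.1 h2
    have h4 : z ∈ Kcls τ i m z := mem_Kcls.2 ⟨hz, Krel.refl _ _⟩
    rw [← h3] at h4
    obtain ⟨y, hy, h5⟩ := mem_image.1 h4
    have := hsub U hU y hy
    unfold shiftLast at h5
    grind

theorem prod_node_erase (hτ : IsNCI i m τ) (hρ : IsNCI (m + 1) j ρ) (him : i ≤ m)
    (hmj : m < j) (w : Finset ℕ → R) :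
    ∏ V ∈ (node m j τ ρ).erase (blk (node m j τ ρ) (j - 1)), w V =
      (∏ V ∈ τ, w V) * ∏ V ∈ ρ.erase (blk ρ (j - 1)), w V := by
  rw [blk_node hτ hρ him hmj, node_erase hτ hρ, prod_union]
  exact (disjoint_of_isNCI hτ hρ).mono_right (erase_subset _ _)

theorem prod_parts (hτ : IsNCI i j τ) (hij : i < j) (w : Finset ℕ → R) :
    ∏ V ∈ τ, w V = w (blk τ (j - 1)) * ∏ V ∈ τ.erase (blk τ (j - 1)), w V :=
  (mul_prod_erase _ _ (hτ.blk_mem (by omega) (by omega)).1).symm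

theorem prod_Kparts (hij : i < j) (w : Finset ℕ → R) :
    ∏ W ∈ Kparts τ i j, w W =
      w (Klast τ i j) * ∏ W ∈ (Kparts τ i j).erase (Klast τ i j), w W :=
  (mul_prod_erase _ _ (mem_Kparts.2 ⟨j - 1, by omega, rfl⟩)).symm

theorem blk_node_card (hτ : IsNCI i m τ) (hρ : IsNCI (m + 1) j ρ) (him : i ≤ m) (hmj : m < j) :
    (blk (node m j τ ρ) (j - 1)).card = (blk ρ (j - 1)).card + 1 := by
  rw [blk_node hτ hρ him hmj, card_insert_of_notMem]
  intro h
  obtain ⟨V, hV, -, h1⟩ := mem_blk.1 h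
  have := hρ.subset V hV m h1
  omega

end Weights

/-! ## Weighted sums over non-crossing partitions -/

section PowerSeriesLemmas

variable {R : Type*} [CommRing R]

theorem coeff_pow_eq_zero {P : R⟦X⟧} (hP : PowerSeries.constantCoeff P = 0) {n p : ℕ} (h : n < p) :
    PowerSeries.coeff n (P ^ p) = 0 :=
  PowerSeries.X_pow_dvd_iff.1 (pow_dvd_pow_of_dvd (PowerSeries.X_dvd_iff.2 hP) p) n h

theorem coeff_subst_eq_sum {P : R⟦X⟧} (hP : PowerSeries.constantCoeff P = 0) (f : R⟦X⟧) (n : ℕ) :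
    PowerSeries.coeff n (PowerSeries.subst P f) =
      ∑ p ∈ range (n + 1), PowerSeries.coeff p f * PowerSeries.coeff n (P ^ p) := by
  rw [PowerSeries.coeff_subst' (PowerSeries.HasSubst.of_constantCoeff_zero' hP),
    finsum_eq_sum_of_support_subset (s := range (n + 1))]
  · simp only [smul_eq_mul]
  · intro p hp
    by_contra h
    have : n < p := by simpa using h
    simp [coeff_pow_eq_zero hP this] at hp

theorem coeff_mul_X_mul (A : R⟦X⟧) (c : ℕ → R) (n : ℕ) :
    PowerSeries.coeff n (A * (PowerSeries.X * PowerSeries.mk c)) =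
      ∑ k ∈ range n, PowerSeries.coeff k A * c (n - 1 - k) := by
  rw [← mul_assoc, mul_comm A, mul_assoc]
  rcases n with _ | n
  · simp
  · rw [PowerSeries.coeff_succ_X_mul, PowerSeries.coeff_mul,
      Nat.sum_antidiagonal_eq_sum_range_succ_mk]
    simp

end PowerSeriesLemmas

theorem card_le_of_subset_interval {i j : ℕ} {V : Finset ℕ} (h : ∀ x ∈ V, i ≤ x ∧ x < j) :
    V.card ≤ j - i := by
  simpa using card_le_card (s := V) (t := Ico i j) fun x hx => mem_Ico.2 (h x hx)

theorem IsNCI.blk_subset {i j x y : ℕ} {P : Finset (Finset ℕ)} (h : IsNCI i j P)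
    (hy : y ∈ blk P x) : i ≤ y ∧ y < j := by
  obtain ⟨V, hV, -, h1⟩ := mem_blk.1 hy
  exact h.subset V hV y h1

theorem card_Klast_le (P : Finset (Finset ℕ)) (i j : ℕ) : (Klast P i j).card ≤ j - i :=
  card_le_of_subset_interval fun _ hx => (mem_Kcls.1 hx).1

theorem Kparts_self (P : Finset (Finset ℕ)) (i : ℕ) : Kparts P i i = ∅ := by simp [Kparts]

theorem Klast_self (P : Finset (Finset ℕ)) (i : ℕ) : Klast P i i = ∅ := by simp [Klast, Kcls]

theorem blk_empty (x : ℕ) : blk ∅ x = ∅ := by simp [blk]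

/-! ### Recursions and generating series for boxed convolution -/

section BoxSums

variable {R : Type*} [CommRing R] (f g : ℕ → R)

/-- The sum over the non-crossing partitions of `[i, j)` that defines the boxed convolution. -/
def boxSum (i j : ℕ) : R :=
  ∑ P ∈ NCI i j, (∏ V ∈ P, f V.card) * ∏ W ∈ Kparts P i j, g W.card

/-- The boxed convolution sum over the partitions whose complement has a last block of size `q`,
which is left out of the product. -/
def sumK (i j q : ℕ) : R :=
  ∑ P ∈ NCI i j, if (Klast P i j).card = q then
    (∏ V ∈ P, f V.card) * ∏ W ∈ (Kparts P i j).erase (Klast P i j), g W.card else 0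

/-- The boxed convolution sum over the partitions with a last block of size `p`, which is left out
of the product. -/
def sumL (i j p : ℕ) : R :=
  ∑ P ∈ NCI i j, if (blk P (j - 1)).card = p then
    (∏ V ∈ P.erase (blk P (j - 1)), f V.card) * ∏ W ∈ Kparts P i j, g W.card else 0

/-- Sorts the partitions by the size of the omitted complement block; this size is at most `j - i`,
which makes the finite range sufficient. -/
theorem sum_mul_sumK (c : ℕ → R) (i j : ℕ) :
    ∑ P ∈ NCI i j, c (Klast P i j).card * ((∏ V ∈ P, f V.card) *
      ∏ W ∈ (Kparts P i j).erase (Klast P i j), g W.card) =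
    ∑ q ∈ range (j - i + 1), c q * sumK f g i j q := by
  simp only [sumK, mul_sum]
  rw [sum_comm]
  refine sum_congr rfl fun P _ => ?_
  simp only [mul_ite, mul_zero]
  rw [sum_ite_eq, if_pos (mem_range.2 (Nat.lt_succ_of_le (card_Klast_le P i j)))]

theorem sum_mul_sumL (c : ℕ → R) (i j : ℕ) :
    ∑ P ∈ NCI i j, c (blk P (j - 1)).card * ((∏ V ∈ P.erase (blk P (j - 1)), f V.card) *
      ∏ W ∈ Kparts P i j, g W.card) =
    ∑ p ∈ range (j - i + 1), c p * sumL f g i j p := by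
  simp only [sumL, mul_sum]
  rw [sum_comm]
  refine sum_congr rfl fun P hP => ?_
  simp only [mul_ite, mul_zero]
  rw [sum_ite_eq, if_pos]
  exact mem_range.2 (Nat.lt_succ_of_le
    (card_le_of_subset_interval fun _ hx => (mem_NCI.1 hP).blk_subset hx))

theorem sumK_self (i q : ℕ) : sumK f g i i q = if q = 0 then 1 else 0 := by
  simp [sumK, NCI_self, Klast_self, Kparts_self, eq_comm]

theorem sumL_self (i p : ℕ) : sumL f g i i p = if p = 0 then 1 else 0 := by
  simp [sumL, NCI_self, blk_empty, Kparts_self, eq_comm]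

theorem sumK_zero {i j : ℕ} (hij : i < j) : sumK f g i j 0 = 0 := by
  refine sum_eq_zero fun P _ => if_neg fun h => ?_
  have : j - 1 ∈ Klast P i j := mem_Kcls.2 ⟨by omega, Krel.refl _ _⟩
  simp [card_eq_zero.1 h] at this

theorem sumL_zero {i j : ℕ} (hij : i < j) : sumL f g i j 0 = 0 := by
  refine sum_eq_zero fun P hP => if_neg fun h => ?_
  have := ((mem_NCI.1 hP).blk_mem (x := j - 1) (by omega) (by omega)).2
  simp [card_eq_zero.1 h] at this

/-- Cutting at `m` removes one point from the last complement block, leaving that of `τ`. The last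
block of the partition has one point more than the last block of `ρ`, whence the weight `f (p + 1)`.
-/
theorem sumK_succ {i j : ℕ} (hij : i < j) (q : ℕ) : sumK f g i j (q + 1) =
    ∑ m ∈ Ico i j, sumK f g i m q *
      ∑ p ∈ range (j - (m + 1) + 1), f (p + 1) * sumL f g (m + 1) j p := by
  simp_rw [← sum_mul_sumL f g fun p => f (p + 1)]
  rw [sumK, sum_NCI hij]
  refine sum_congr rfl fun m hm => ?_
  obtain ⟨him, hmj⟩ := mem_Ico.1 hm
  rw [sumK, sum_mul_sum]
  refine sum_congr rfl fun τ hτ => sum_congr rfl fun ρ hρ => ?_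
  rw [mem_NCI] at hτ hρ
  rw [Klast_node_card hτ hρ him hmj, prod_Kparts_node_erase hτ hρ him hmj,
    prod_parts (hτ.isNCI_node hρ him hmj) hij fun V => f V.card,
    prod_node_erase hτ hρ him hmj fun V => f V.card, blk_node_card hτ hρ him hmj]
  simp only [add_left_inj, ite_mul, zero_mul]
  split_ifs
  · ring
  · rfl

/-- The mirror image of `sumK_succ`: the omitted last block loses `m` and becomes that of `ρ`, while
the last complement block, one point larger than that of `τ`, is now counted and has weight `g (q +
1)`. -/
theorem sumL_succ {i j : ℕ} (hij : i < j) (p : ℕ) : sumL f g i j (p + 1) =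
    ∑ m ∈ Ico i j, (∑ q ∈ range (m - i + 1), g (q + 1) * sumK f g i m q) *
      sumL f g (m + 1) j p := by
  simp_rw [← sum_mul_sumK f g fun q => g (q + 1)]
  rw [sumL, sum_NCI hij]
  refine sum_congr rfl fun m hm => ?_
  obtain ⟨him, hmj⟩ := mem_Ico.1 hm
  rw [sumL, sum_mul_sum]
  refine sum_congr rfl fun τ hτ => sum_congr rfl fun ρ hρ => ?_
  rw [mem_NCI] at hτ hρ
  rw [blk_node_card hτ hρ him hmj, prod_node_erase hτ hρ him hmj fun V => f V.card,
    prod_Kparts hij fun W => g W.card, Klast_node_card hτ hρ him hmj,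
    prod_Kparts_node_erase hτ hρ him hmj]
  simp only [add_left_inj, mul_ite, mul_zero]
  split_ifs
  · ring
  · rfl

theorem boxSum_eq_sumL {i j : ℕ} (hij : i < j) :
    boxSum f g i j = ∑ p ∈ range (j - i + 1), f p * sumL f g i j p := by
  rw [← sum_mul_sumL, boxSum]
  refine sum_congr rfl fun P hP => ?_
  rw [prod_parts (mem_NCI.1 hP) hij fun V => f V.card, mul_assoc]

/-- The generating series of the sums in which the last block has one point. -/
def serL : R⟦X⟧ := PowerSeries.X * PowerSeries.mk fun n =>
  ∑ q ∈ range (n + 1), g (q + 1) * sumK f g 0 n q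

/-- The generating series of the sums in which the last block of the complement has one point. -/
def serK : R⟦X⟧ := PowerSeries.X * PowerSeries.mk fun n =>
  ∑ p ∈ range (n + 1), f (p + 1) * sumL f g 0 n p

/-- Both recursions say that enlarging the omitted block by one point multiplies the generating
series by a fixed series. The induction is joint because each recursion involves both sums, and it
quantifies over `i` so that it also shows that only the length of the interval matters. -/
theorem coeff_serK_serL (n : ℕ) : (∀ i q, sumK f g i (i + n) q =
      PowerSeries.coeff n (serK f g ^ q)) ∧
    ∀ i p, sumL f g i (i + n) p = PowerSeries.coeff n (serL f g ^ p) := by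
  induction n using Nat.strong_induction_on with
  | _ n ih =>
    rcases n.eq_zero_or_pos with rfl | hn
    · refine ⟨fun i q => ?_, fun i p => ?_⟩
      · rw [add_zero, sumK_self]
        rcases q with _ | q <;> simp [serK]
      · rw [add_zero, sumL_self]
        rcases p with _ | p <;> simp [serL]
    · refine ⟨fun i q => ?_, fun i p => ?_⟩
      · rcases q with _ | q
        · rw [sumK_zero f g (by omega), pow_zero, PowerSeries.coeff_one, if_neg (by omega)]
        · rw [sumK_succ f g (by omega), sum_Ico_eq_sum_range, pow_succ]
          -- Only the last factor is unfolded. Its factor `X` makes all lengths smaller than `n`, so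
          -- that the induction hypothesis applies.
          nth_rw 2 [serK]
          rw [coeff_mul_X_mul, Nat.add_sub_cancel_left]
          refine sum_congr rfl fun k hk => ?_
          have hk := mem_range.1 hk
          rw [(ih k hk).1, show i + n - (i + k + 1) = n - 1 - k by omega]
          congr 1
          refine sum_congr rfl fun p _ => ?_
          have h1 := (ih (n - 1 - k) (by omega)).2 (i + k + 1) p
          have h2 := (ih (n - 1 - k) (by omega)).2 0 p
          rw [show i + k + 1 + (n - 1 - k) = i + n by omega] at h1
          rw [zero_add] at h2
          rw [h1, h2]
      · rcases p with _ | p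
        · rw [sumL_zero f g (by omega), pow_zero, PowerSeries.coeff_one, if_neg (by omega)]
        · rw [sumL_succ f g (by omega), sum_Ico_eq_sum_range, pow_succ]
          nth_rw 2 [serL]
          -- Here the shorter sum of the same kind lives on the right part, so the summation order
          -- is reversed to match the product of series.
          rw [coeff_mul_X_mul, Nat.add_sub_cancel_left, ← sum_range_reflect]
          refine sum_congr rfl fun k hk => ?_
          have hk := mem_range.1 hk
          have h1 := (ih k hk).2 (i + (n - 1 - k) + 1) p
          rw [show i + (n - 1 - k) + 1 + k = i + n by omega] at h1
          rw [h1, mul_comm, Nat.add_sub_cancel_left]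
          congr 1
          refine sum_congr rfl fun q _ => ?_
          have h2 := (ih (n - 1 - k) (by omega)).1 0 q
          rw [zero_add] at h2
          rw [h2, (ih (n - 1 - k) (by omega)).1]

theorem constantCoeff_serL : PowerSeries.constantCoeff (serL f g) = 0 := by simp [serL]

theorem constantCoeff_serK : PowerSeries.constantCoeff (serK f g) = 0 := by simp [serK]

/-- Once the sums over `q` are coefficients of powers of `serK`, summing them with the weights `g (q
+ 1)` is a substitution. -/
theorem serL_eq : serL f g = PowerSeries.X *
    PowerSeries.subst (serK f g) (PowerSeries.mk fun n => g (n + 1)) := by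
  conv_lhs => rw [serL]
  congr 1
  ext n
  rw [coeff_subst_eq_sum (constantCoeff_serK f g), PowerSeries.coeff_mk]
  refine sum_congr rfl fun q _ => ?_
  have := (coeff_serK_serL f g n).1 0 q
  rw [zero_add] at this
  rw [this, PowerSeries.coeff_mk]

theorem serK_eq : serK f g = PowerSeries.X *
    PowerSeries.subst (serL f g) (PowerSeries.mk fun n => f (n + 1)) := by
  conv_lhs => rw [serK]
  congr 1
  ext n
  rw [coeff_subst_eq_sum (constantCoeff_serL f g), PowerSeries.coeff_mk]
  refine sum_congr rfl fun p _ => ?_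
  have := (coeff_serK_serL f g n).2 0 p
  rw [zero_add] at this
  rw [this, PowerSeries.coeff_mk]

theorem boxSum_eq_coeff {n : ℕ} (hn : 0 < n) : boxSum f g 0 n =
    PowerSeries.coeff n (PowerSeries.subst (serL f g) (PowerSeries.mk f)) := by
  rw [boxSum_eq_sumL f g hn, coeff_subst_eq_sum (constantCoeff_serL f g)]
  refine sum_congr rfl fun p _ => ?_
  have := (coeff_serK_serL f g n).2 0 p
  rw [zero_add] at this
  rw [this, PowerSeries.coeff_mk]

end BoxSums

/-! ## Transfer from partitions of `[n]` -/

section Transfer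

variable {n : ℕ}

/-- The blocks of a partition of `[n]` as sets of natural numbers. -/
def natParts (π : Part n) : Finset (Finset ℕ) := π.parts.image (·.map Fin.valEmbedding)

theorem map_val_injective : Function.Injective fun V : Finset (Fin n) => V.map Fin.valEmbedding :=
  Finset.map_injective _

theorem mem_natParts {π : Part n} {V : Finset ℕ} :
    V ∈ natParts π ↔ ∃ U ∈ π.parts, U.map Fin.valEmbedding = V := by
  simp [natParts]

theorem natParts_injective : Function.Injective (natParts (n := n)) := fun _ _ h =>
  Finpartition.ext (image_injective map_val_injective h)

theorem prod_natParts {R : Type*} [CommMonoid R] (π : Part n) (w : Finset ℕ → R) :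
    ∏ V ∈ natParts π, w V = ∏ V ∈ π.parts, w (V.map Fin.valEmbedding) :=
  prod_image fun _ _ _ _ h => map_val_injective h

theorem isNCI_natParts {π : Part n} (hπ : IsNonCrossing π) : IsNCI 0 n (natParts π) := by
  constructor
  · intro V hV
    obtain ⟨U, hU, rfl⟩ := mem_natParts.1 hV
    simpa using π.nonempty_of_mem_parts hU
  · intro V hV x hx
    obtain ⟨U, hU, rfl⟩ := mem_natParts.1 hV
    obtain ⟨y, -, rfl⟩ := mem_map.1 hx
    simp
  · intro x _ hx
    obtain ⟨U, hU, h⟩ := π.exists_mem (mem_univ (⟨x, hx⟩ : Fin n))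
    exact ⟨_, mem_natParts.2 ⟨U, hU, rfl⟩, mem_map.2 ⟨_, h, rfl⟩⟩
  · intro V hV W hW x hx hx'
    obtain ⟨U, hU, rfl⟩ := mem_natParts.1 hV
    obtain ⟨U', hU', rfl⟩ := mem_natParts.1 hW
    obtain ⟨y, hy, rfl⟩ := mem_map.1 hx
    rw [mem_map'] at hx'
    rw [π.eq_of_mem_parts hU hU' hy hx']
  · intro V hV W hW p q r s h1 h2 h3 hp hq hr hs
    obtain ⟨U, hU, rfl⟩ := mem_natParts.1 hV
    obtain ⟨U', hU', rfl⟩ := mem_natParts.1 hW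
    obtain ⟨p, hp', rfl⟩ := mem_map.1 hp
    obtain ⟨q, hq', rfl⟩ := mem_map.1 hq
    obtain ⟨r, hr', rfl⟩ := mem_map.1 hr
    obtain ⟨s, hs', rfl⟩ := mem_map.1 hs
    obtain ⟨U'', hU'', h4, h5⟩ := hπ p q r s h1 h2 h3 ⟨U, hU, hp', hr'⟩ ⟨U', hU', hq', hs'⟩
    rw [π.eq_of_mem_parts hU hU'' hr' h5, π.eq_of_mem_parts hU' hU'' hq' h4]

theorem exists_natParts_eq {P : Finset (Finset ℕ)} (hP : IsNCI 0 n P) :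
    ∃ π ∈ NC n, natParts π = P := by
  have hpre : ∀ V ∈ P, (univ.filter fun x : Fin n => (x : ℕ) ∈ V).map Fin.valEmbedding = V := by
    intro V hV
    ext x
    simp only [mem_map, mem_filter, mem_univ, true_and, Fin.valEmbedding_apply]
    exact ⟨fun ⟨y, hy, h⟩ => h ▸ hy, fun hx => ⟨⟨x, (hP.subset V hV x hx).2⟩, hx, rfl⟩⟩
  -- The blocks are the preimages of the blocks of `P` in `Fin n`; nothing is lost, since `P` lives
  -- on `[0, n)`.
  let π : Part n := Finpartition.ofExistsUnique
    (P.image fun V => univ.filter fun x : Fin n => (x : ℕ) ∈ V) (fun _ _ => subset_univ _)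
    (by
      intro x _
      obtain ⟨V, hV, hx⟩ := hP.cover x (Nat.zero_le _) x.2
      refine ⟨_, ⟨mem_image_of_mem _ hV, by simpa using hx⟩, ?_⟩
      rintro U ⟨hU, hxU⟩
      obtain ⟨W, hW, rfl⟩ := mem_image.1 hU
      rw [hP.eq_of_mem W hW V hV x (by simpa using hxU) hx])
    (by
      intro h
      obtain ⟨V, hV, h⟩ := mem_image.1 h
      have := hpre V hV
      rw [h, map_empty] at this
      simpa [← this] using hP.nonempty V hV)
  have hparts : π.parts = P.image fun V => univ.filter fun x : Fin n => (x : ℕ) ∈ V := rfl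
  have hnat : natParts π = P := by
    rw [natParts, hparts, image_image]
    ext V
    rw [mem_image]
    constructor
    · rintro ⟨W, hW, rfl⟩
      rw [Function.comp_apply, hpre W hW]
      exact hW
    · exact fun hV => ⟨V, hV, hpre V hV⟩
  refine ⟨π, ?_, hnat⟩
  rw [NC, mem_filter]
  refine ⟨mem_univ _, fun p q r s h1 h2 h3 h4 h5 => ?_⟩
  obtain ⟨U, hU, hp, hr⟩ := h4
  obtain ⟨U', hU', hq, hs⟩ := h5
  have h6 := hP.noncrossing (U.map Fin.valEmbedding) (hnat ▸ mem_natParts.2 ⟨U, hU, rfl⟩)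
    (U'.map Fin.valEmbedding) (hnat ▸ mem_natParts.2 ⟨U', hU', rfl⟩) p q r s h1 h2 h3
    (mem_map.2 ⟨p, hp, rfl⟩) (mem_map.2 ⟨q, hq, rfl⟩) (mem_map.2 ⟨r, hr, rfl⟩)
    (mem_map.2 ⟨s, hs, rfl⟩)
  exact ⟨U, hU, map_val_injective h6 ▸ hq, hr⟩

theorem sum_NC_eq_sum_NCI {R : Type*} [AddCommMonoid R] (F : Finset (Finset ℕ) → R) :
    ∑ π ∈ NC n, F (natParts π) = ∑ P ∈ NCI 0 n, F P := by
  refine sum_bij (fun π _ => natParts π) ?_ ?_ ?_ fun _ _ => rfl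
  · exact fun π hπ => mem_NCI.2 (isNCI_natParts (mem_filter.1 hπ).2)
  · exact fun _ _ _ _ h => natParts_injective h
  · intro P hP
    obtain ⟨π, hπ, h⟩ := exists_natParts_eq (mem_NCI.1 hP)
    exact ⟨π, hπ, h⟩

theorem krel_natParts (π : Part n) (x y : Fin n) :
    Krel (natParts π) x y ↔ SameBlock (kreweras π) x y := by
  rw [sameBlock_kreweras]
  constructor
  · rintro h p q ⟨V, hV, hp, hq⟩
    exact h _ (mem_natParts.2 ⟨V, hV, rfl⟩) p (mem_map.2 ⟨p, hp, rfl⟩) q (mem_map.2 ⟨q, hq, rfl⟩)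
  · intro h V hV p hp q hq
    obtain ⟨U, hU, rfl⟩ := mem_natParts.1 hV
    obtain ⟨p, hp', rfl⟩ := mem_map.1 hp
    obtain ⟨q, hq', rfl⟩ := mem_map.1 hq
    exact h p q ⟨U, hU, hp', hq'⟩

theorem Kparts_natParts (π : Part n) : Kparts (natParts π) 0 n = natParts (kreweras π) := by
  have key : ∀ x : Fin n, Kcls (natParts π) 0 n x =
      ((kreweras π).part x).map Fin.valEmbedding := by
    intro x
    ext y
    rw [mem_Kcls, mem_map]
    constructor
    · rintro ⟨⟨-, hy⟩, h⟩
      exact ⟨⟨y, hy⟩, (sameBlock_iff_mem_part _ _ _).1 ((krel_natParts π x ⟨y, hy⟩).1 h), rfl⟩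
    · rintro ⟨y, hy, rfl⟩
      exact ⟨⟨Nat.zero_le _, y.2⟩, (krel_natParts π x y).2 ((sameBlock_iff_mem_part _ _ _).2 hy)⟩
  ext V
  rw [mem_Kparts, mem_natParts]
  constructor
  · rintro ⟨x, ⟨-, hx⟩, rfl⟩
    exact ⟨_, (kreweras π).part_mem.2 (mem_univ _), (key ⟨x, hx⟩).symm⟩
  · rintro ⟨U, hU, rfl⟩
    obtain ⟨x, hx⟩ := (kreweras π).nonempty_of_mem_parts hU
    exact ⟨x, ⟨Nat.zero_le _, x.2⟩, by rw [key, (kreweras π).part_eq_of_mem hU hx]⟩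

theorem coeff_boxConv_eq_boxSum {R : Type*} [CommRing R] (f g : SeriesM R) (hn : n ≠ 0) :
    PowerSeries.coeff n (boxConv f g).1 =
      boxSum (fun k => PowerSeries.coeff k f.1) (fun k => PowerSeries.coeff k g.1) 0 n := by
  rw [boxConv, SeriesM.coeff_mk _ hn, boxSum, ← sum_NC_eq_sum_NCI]
  refine sum_congr rfl fun π _ => ?_
  rw [Kparts_natParts, prod_natParts, prod_natParts]
  simp only [card_map]

end Transfer

/-- The series `f(z) / z`. -/
def divX {R : Type*} [CommRing R] (f : R⟦X⟧) : R⟦X⟧ :=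
  PowerSeries.mk fun n => PowerSeries.coeff (n + 1) f

/-- The functional equations for the boxed convolution. -/
theorem exists_boxConv_eq_subst {R : Type*} [CommRing R] (f g : SeriesM R) :
    ∃ P Q : R⟦X⟧, PowerSeries.constantCoeff P = 0 ∧ PowerSeries.constantCoeff Q = 0 ∧
      P = PowerSeries.X * PowerSeries.subst Q (divX g.1) ∧
      Q = PowerSeries.X * PowerSeries.subst P (divX f.1) ∧
      (boxConv f g).1 = PowerSeries.subst P f.1 := by
  let F : ℕ → R := fun k => PowerSeries.coeff k f.1
  let G : ℕ → R := fun k => PowerSeries.coeff k g.1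
  refine ⟨serL F G, serK F G, constantCoeff_serL F G, constantCoeff_serK F G, serL_eq F G,
    serK_eq F G, ?_⟩
  have hF : f.1 = PowerSeries.mk F := by ext n; simp [F]
  ext n
  rcases eq_or_ne n 0 with rfl | hn
  · rw [SeriesM.coeff_zero, PowerSeries.coeff_zero_eq_constantCoeff_apply]
    exact (PowerSeries.constantCoeff_subst_eq_zero (constantCoeff_serL F G) _ f.2).symm
  · exact (coeff_boxConv_eq_boxSum f g hn).trans
      ((boxSum_eq_coeff F G (by omega)).trans (by rw [← hF]))

/-! ## Multiplicativity of the transform `𝓕` -/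

section Series

variable {R : Type*} [CommRing R]

open PowerSeries (X subst HasSubst constantCoeff)

theorem X_mul_divX {f : R⟦X⟧} (hf : constantCoeff f = 0) : X * divX f = f := by
  ext n
  rcases n with _ | n
  · simp [hf]
  · simp [divX, PowerSeries.coeff_succ_X_mul]

theorem subst_one {P : R⟦X⟧} (hP : HasSubst P) : subst P (1 : R⟦X⟧) = 1 := by
  rw [← PowerSeries.coe_substAlgHom hP, map_one]

theorem subst_eq_mul_divX {f P : R⟦X⟧} (hf : constantCoeff f = 0) (hP : constantCoeff P = 0) :
    subst P f = P * subst P (divX f) := by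
  have hs := HasSubst.of_constantCoeff_zero' hP
  conv_lhs => rw [← X_mul_divX hf]
  rw [PowerSeries.subst_mul hs, PowerSeries.subst_X hs]

/-- The functional equations for the boxed convolution, in product form. -/
theorem exists_boxConv_eq_subst' (f g : SeriesM R) :
    ∃ P Q : R⟦X⟧, constantCoeff P = 0 ∧ constantCoeff Q = 0 ∧
      P = X * subst Q (divX g.1) ∧ P * Q = X * (boxConv f g).1 ∧
      (boxConv f g).1 = subst P f.1 ∧ (boxConv f g).1 = subst Q g.1 := by
  obtain ⟨P, Q, hP, hQ, h1, h2, h3⟩ := exists_boxConv_eq_subst f g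
  have h4 := subst_eq_mul_divX f.2 hP
  have h5 := subst_eq_mul_divX g.2 hQ
  -- Since `P·(f/z)(P) = f(P)`, multiplying the equation for `Q` by `P` gives `P·Q = z·f(P)`. By
  -- symmetry `P·Q = z·g(Q)`, which yields the last claim.
  have h6 : P * Q = X * (boxConv f g).1 := by
    rw [h3, h4]
    linear_combination P * h2
  refine ⟨P, Q, hP, hQ, h1, h6, h3, PowerSeries.X_mul_cancel ?_⟩
  rw [← h6, h5]
  linear_combination Q * h1

theorem eq_subst_compInv {f : SeriesG R} {P h : R⟦X⟧} (hP : constantCoeff P = 0)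
    (h1 : subst P f.1.1 = h) : P = subst h (compInv f) := by
  have := PowerSeries.subst_comp_subst_apply (hasSubst_of_mem f.1)
    (HasSubst.of_constantCoeff_zero' hP) (compInv f)
  rwa [subst_compInv_left, PowerSeries.subst_X (HasSubst.of_constantCoeff_zero' hP), h1] at this

theorem subst_compInv_eq {f : SeriesG R} {h : R⟦X⟧} (hh : constantCoeff h = 0) :
    subst h (compInv f) = h * subst h (transF f) := by
  have hs := HasSubst.of_constantCoeff_zero' hh
  rw [← X_mul_transF, PowerSeries.subst_mul hs, PowerSeries.subst_X hs]

/-- Substituting the compositional inverse undoes the substitution. -/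
theorem subst_injective (h : SeriesG R) : Function.Injective (subst h.1.1 : R⟦X⟧ → R⟦X⟧) := by
  refine Function.LeftInverse.injective (g := subst (compInv h)) fun A => ?_
  rw [PowerSeries.subst_comp_subst_apply (hasSubst_of_mem h.1) (hasSubst_compInv h),
    subst_compInv_right, ← PowerSeries.map_algebraMap_eq_subst_X]
  simp

/-- Inverting gives `P = h·𝓕(f)(h)`, `Q = h·𝓕(g)(h)` and `z = h·𝓕(h)(h)`, so the hypothesis on `P *
Q` compares two series composed with `h`. The case `u = 1` serves `⊠`, the case `u = 1 + z` the
product of free variables. -/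
theorem transF_mul_transF {f g h : SeriesG R} {P Q u : R⟦X⟧} (hP : constantCoeff P = 0)
    (hQ : constantCoeff Q = 0) (h1 : subst P f.1.1 = h.1.1) (h2 : subst Q g.1.1 = h.1.1)
    (h3 : P * Q = X * (h.1.1 * subst h.1.1 u)) : transF f * transF g = transF h * u := by
  have hs := hasSubst_of_mem h.1
  have e1 := (eq_subst_compInv hP h1).trans (subst_compInv_eq h.1.2)
  have e2 := (eq_subst_compInv hQ h2).trans (subst_compInv_eq h.1.2)
  have e3 : X = h.1.1 * subst h.1.1 (transF h) := by
    rw [← subst_compInv_eq h.1.2, subst_compInv_left]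
  -- The factor `X²` becomes `h²` after substitution, so that `h` itself never has to be cancelled.
  have key : subst h.1.1 (X * (X * (transF f * transF g))) =
      subst h.1.1 (X * (X * (transF h * u))) := by
    simp only [PowerSeries.subst_mul hs, PowerSeries.subst_X hs]
    rw [e1, e2] at h3
    linear_combination h3 + (h.1.1 * subst h.1.1 u) * e3
  exact PowerSeries.X_mul_cancel (PowerSeries.X_mul_cancel (subst_injective h key))

theorem transF_boxRightG (f g : SeriesG R) : transF (boxRightG g f) = transF f * transF g := by
  obtain ⟨P, Q, hP, hQ, -, h6, h7, h8⟩ := exists_boxConv_eq_subst' f.1 g.1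
  have := transF_mul_transF (h := boxRightG g f) (u := 1) hP hQ h7.symm h8.symm (by
    rw [h6, subst_one (hasSubst_of_mem _), mul_one]
    rfl)
  rw [this, mul_one]

/-! ### Special values of `𝓕` and the algebra of `⊠` -/

theorem transF_unitG : transF (unitG R) = 1 := by
  apply PowerSeries.X_mul_cancel
  rw [X_mul_transF, mul_one]
  have h2 := subst_compInv_right (unitG R)
  rwa [show (unitG R).1.1 = X from rfl, PowerSeries.subst_X (hasSubst_compInv _)] at h2

theorem divX_zeta : divX (zeta R).1 * (1 - X) = 1 := by
  ext n
  rcases n with _ | n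
  · simp [divX, zeta, SeriesM.mk]
  · rw [mul_sub, mul_one, map_sub, PowerSeries.coeff_succ_mul_X]
    simp [divX, zeta, SeriesM.mk, PowerSeries.coeff_one]

theorem zeta_eq : (zeta R).1 = X + (zeta R).1 * X := by
  rw [← X_mul_divX (zeta R).2]
  linear_combination X * divX_zeta (R := R)

/-- The relation `Zeta₁ = z + z·Zeta₁`, composed with the inverse `w` of `Zeta₁`, reads `z = w +
z·w`. -/
theorem transF_zetaG : transF (zetaG R) * (1 + X) = 1 := by
  have hs := hasSubst_compInv (zetaG R)
  have h1 := subst_compInv_right (zetaG R)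
  have h2 : X = compInv (zetaG R) + X * compInv (zetaG R) := by
    have h3 := congrArg (subst (compInv (zetaG R))) (zeta_eq (R := R))
    rwa [PowerSeries.subst_add hs, PowerSeries.subst_mul hs, PowerSeries.subst_X hs,
      show (zeta R).1 = (zetaG R).1.1 from rfl, h1] at h3
  rw [← X_mul_transF] at h2
  apply PowerSeries.X_mul_cancel
  linear_combination -h2

theorem transF_moebG : transF (moebG R) = 1 + X := by
  have h1 := transF_boxRightG (moebG R) (zetaG R)
  rw [show boxRightG (zetaG R) (moebG R) = unitG R from
    (boxRightG (zetaG R)).apply_symm_apply (unitG R), transF_unitG] at h1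
  linear_combination (-(1 + X)) * h1 - transF (moebG R) * transF_zetaG (R := R)

/-- Multiplication of power series is associative and commutative, and the injective transform `𝓕`
carries these laws back to `⊠`. -/
theorem boxRightG_assoc (f g h : SeriesG R) :
    boxRightG h (boxRightG g f) = boxRightG (boxRightG h g) f :=
  transF_injective (by simp only [transF_boxRightG, mul_assoc])

theorem boxRightG_comm (f g : SeriesG R) : boxRightG g f = boxRightG f g :=
  transF_injective (by rw [transF_boxRightG, transF_boxRightG, mul_comm])

theorem boxRightG_unitG (f : SeriesG R) : boxRightG (unitG R) f = f :=
  transF_injective (by rw [transF_boxRightG, transF_unitG, mul_one])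

theorem boxRightG_zetaG_moebG (f : SeriesG R) :
    boxRightG (moebG R) (boxRightG (zetaG R) f) = f := by
  apply transF_injective
  rw [transF_boxRightG, transF_boxRightG, transF_moebG, mul_assoc, transF_zetaG, mul_one]

/-- No condition is put on the linear coefficient of `h`, so `h` need not be invertible under
composition. Instead, `m = h ⊠ Zeta₁` satisfies `m = h(z(1+m))`, and `t = m ⊠ Moeb₁ = m(P)` with
`P·(1+t) = z`. Thus `P` is a right compositional inverse of `z(1+m)`, and `t = h`. -/
theorem boxConv_zeta_boxConv_moeb (h : SeriesM R) :
    boxConv (boxConv h (zeta R)) (moeb R) = h := by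
  set m := boxConv h (zeta R) with hm
  have h1 : m.1 = subst (X * (1 + m.1)) h.1 := by
    obtain ⟨P, Q, hP, hQ, h1, h2, h3, -⟩ := exists_boxConv_eq_subst' h (zeta R)
    have hs := HasSubst.of_constantCoeff_zero' hQ
    have h4 := congrArg (subst Q) (divX_zeta (R := R))
    rw [PowerSeries.subst_mul hs, PowerSeries.subst_sub hs, PowerSeries.subst_X hs,
      subst_one hs] at h4
    have h5 : P = X * (1 + m.1) := by
      rw [hm]
      linear_combination (1 - Q) * h1 + X * h4 + h2
    rw [← h5]
    exact h3
  obtain ⟨P, Q, hP, hQ, h2, -, h3, h4⟩ := exists_boxConv_eq_subst' m (moeb R)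
  set t := boxConv m (moeb R) with ht
  have hst := hasSubst_of_mem t
  have hsP := HasSubst.of_constantCoeff_zero' hP
  have hQt : Q = subst t.1 (compInv (moebG R)) := eq_subst_compInv (f := moebG R) hQ h4.symm
  -- From `𝓕(Moeb₁) = 1+z` the inverse of `Moeb₁` is `z(1+z)`, hence `Moeb₁/z` evaluated there is
  -- `1/(1+z)`.
  have h5 : (1 + X) * subst (compInv (moebG R)) (divX (moeb R).1) = 1 := by
    have h6 := subst_compInv_right (moebG R)
    rw [show (moebG R).1.1 = (moeb R).1 from rfl,
      subst_eq_mul_divX (moeb R).2 (by simp [compInv])] at h6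
    apply PowerSeries.X_mul_cancel
    rw [← X_mul_transF] at h6 ⊢
    rw [transF_moebG] at h6 ⊢
    linear_combination h6
  have h7 : (1 + t.1) * subst Q (divX (moeb R).1) = 1 := by
    have h8 := congrArg (subst t.1) h5
    rw [PowerSeries.subst_mul hst, PowerSeries.subst_add hst, PowerSeries.subst_X hst,
      PowerSeries.subst_comp_subst_apply (hasSubst_compInv _) hst, ← hQt,
      subst_one hst] at h8
    exact h8
  have h9 : subst P (X * (1 + m.1)) = X := by
    rw [PowerSeries.subst_mul hsP, PowerSeries.subst_add hsP, PowerSeries.subst_X hsP, ← h3,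
      subst_one hsP]
    linear_combination (1 + t.1) * h2 + X * h7
  apply Subtype.ext
  rw [h3, h1, PowerSeries.subst_comp_subst_apply
    (HasSubst.of_constantCoeff_zero' (by simp)) hsP, h9, ← PowerSeries.map_algebraMap_eq_subst_X]
  simp

/-! ### `LOG`, `EXP` and `EXP_V` as homomorphisms -/

variable [Algebra ℚ R]

/-- The logarithmic derivative of a product is the sum of the logarithmic derivatives. It is
characterised by `L·u = u'`, so the claim is checked after multiplication by the unit `𝓕(f ⊠ g)`. -/
theorem LOG_boxRightG (f g : SeriesG R) : LOG (boxRightG g f) = LOG f + LOG g := by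
  apply Subtype.ext
  change X * PowerSeries.derivative R (PowerSeries.logOf (transF (boxRightG g f))) =
    X * PowerSeries.derivative R (PowerSeries.logOf (transF f)) +
      X * PowerSeries.derivative R (PowerSeries.logOf (transF g))
  have h1 := derivative_logOf_mul _ (constantCoeff_transF f)
  have h2 := derivative_logOf_mul _ (constantCoeff_transF g)
  have h3 := derivative_logOf_mul _ (constantCoeff_transF (boxRightG g f))
  have hu : IsUnit (transF (boxRightG g f)) :=
    PowerSeries.isUnit_iff_constantCoeff.2 (by rw [constantCoeff_transF]; exact isUnit_one)
  apply hu.mul_right_cancel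
  rw [mul_assoc, h3, transF_boxRightG, Derivation.leibniz, smul_eq_mul, smul_eq_mul]
  linear_combination (-(X * transF g)) * h1 - X * transF f * h2

theorem LOG_EXP (f : SeriesM R) : LOG (EXP f) = f :=
  (Equiv.ofBijective LOG LOG_bijective).apply_symm_apply f

theorem EXP_LOG (f : SeriesG R) : EXP (LOG f) = f :=
  (Equiv.ofBijective LOG LOG_bijective).symm_apply_apply f

theorem EXP_add (f g : SeriesM R) : EXP (f + g) = boxRightG (EXP g) (EXP f) := by
  rw [← EXP_LOG (boxRightG (EXP g) (EXP f)), LOG_boxRightG, LOG_EXP, LOG_EXP]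

/-- The unit is idempotent under `⊠`, so its `LOG` equals twice itself. -/
theorem EXP_zero : EXP (0 : SeriesM R) = unitG R := by
  have h : LOG (unitG R) = 0 := by
    have := LOG_boxRightG (unitG R) (unitG R)
    rw [boxRightG_unitG] at this
    simpa using this
  rw [← h, EXP_LOG]

theorem EXPV_eq (f : SeriesM R) :
    EXPV f = boxRightG (zetaG R) (EXP (boxConv f (moeb R))) := rfl

theorem EXPV_zero : EXPV (0 : SeriesM R) = zetaG R := by
  have h : boxConv (0 : SeriesM R) (moeb R) = 0 := by
    obtain ⟨P, Q, hP, -, -, -, h3, -⟩ := exists_boxConv_eq_subst' 0 (moeb R)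
    apply Subtype.ext
    rw [h3]
    change subst P (0 : R⟦X⟧) = 0
    rw [← PowerSeries.coe_substAlgHom (HasSubst.of_constantCoeff_zero' hP), map_zero]
  rw [EXPV_eq, h, EXP_zero, boxRightG_comm, boxRightG_unitG]

/-- The outer `Zeta₁` of `⊞_V` cancels against the `Moeb₁` in `EXP_V`. On the other side `Moeb₁`
cancels the `Zeta₁` of the first factor. -/
theorem EXPV_boxPlusV (f g : SeriesM R) :
    EXPV (boxPlusV f g) = boxRightG (EXPV g) (boxRightG (moebG R) (EXPV f)) := by
  rw [EXPV_eq f, EXPV_eq, boxPlusV, boxConv_zeta_boxConv_moeb, EXP_add, boxRightG_zetaG_moebG,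
    EXPV_eq, boxRightG_assoc]

end Series

/-! ## Partitions of alternating words -/

section Alternating

variable {R : Type*} [CommRing R] (κ : ℕ → ℕ → R)

/-- The weight of a block in an alternating word, where the position `v` has the colour `v % 2`:
blocks with both colours have weight zero. -/
def altWeight (V : Finset ℕ) : R :=
  if ∀ v ∈ V, v % 2 = 0 then κ 0 V.card else if ∀ v ∈ V, v % 2 = 1 then κ 1 V.card else 0

/-- The weighted sum over the partitions of the alternating word at the positions `[i, j)`. -/
def altSum (i j : ℕ) : R := ∑ P ∈ NCI i j, ∏ V ∈ P, altWeight κ V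

/-- The weighted sum over the partitions with a last block of size `p` and colour `c`, which is left
out of the product. -/
def altSumL (c i j p : ℕ) : R :=
  ∑ P ∈ NCI i j, if (blk P (j - 1)).card = p ∧ ∀ v ∈ blk P (j - 1), v % 2 = c then
    ∏ V ∈ P.erase (blk P (j - 1)), altWeight κ V else 0

theorem altWeight_eq {c : ℕ} (hc : c < 2) {V : Finset ℕ} {x : ℕ} (hx : x ∈ V) (hxc : x % 2 = c) :
    altWeight κ V = if ∀ v ∈ V, v % 2 = c then κ c V.card else 0 := by
  unfold altWeight
  interval_cases c
  · split_ifs with h1 h2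
    · rfl
    · have := h2 x hx; omega
    · rfl
  · have : ¬ ∀ v ∈ V, v % 2 = 0 := fun h => by have := h x hx; omega
    rw [if_neg this]

theorem altSum_self (i : ℕ) : altSum κ i i = 1 := by simp [altSum, NCI_self]

theorem altSumL_self (c i p : ℕ) : altSumL κ c i i p = if p = 0 then 1 else 0 := by
  simp [altSumL, NCI_self, blk_empty, eq_comm]

theorem altSumL_zero (c : ℕ) {i j : ℕ} (hij : i < j) : altSumL κ c i j 0 = 0 := by
  refine sum_eq_zero fun P hP => if_neg fun h => ?_
  have := ((mem_NCI.1 hP).blk_mem (x := j - 1) (by omega) (by omega)).2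
  simp [card_eq_zero.1 h.1] at this

/-- The same cut as before: `m` must have the colour of the last block, the word left of `m` is
counted in full, and the rest of the last block belongs to the right part. -/
theorem altSumL_succ (c : ℕ) {i j : ℕ} (hij : i < j) (p : ℕ) : altSumL κ c i j (p + 1) =
    ∑ m ∈ Ico i j, if m % 2 = c then altSum κ i m * altSumL κ c (m + 1) j p else 0 := by
  rw [altSumL, sum_NCI hij]
  refine sum_congr rfl fun m hm => ?_
  obtain ⟨him, hmj⟩ := mem_Ico.1 hm
  rw [altSum, altSumL, sum_mul_sum, ite_sum_zero]
  refine sum_congr rfl fun τ hτ => ?_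
  rw [ite_sum_zero]
  refine sum_congr rfl fun ρ hρ => ?_
  rw [mem_NCI] at hτ hρ
  rw [blk_node_card hτ hρ him hmj, prod_node_erase hτ hρ him hmj, blk_node hτ hρ him hmj]
  simp only [add_left_inj, mem_insert, forall_eq_or_imp, mul_ite, mul_zero, ← ite_and]
  congr 1
  exact propext (by tauto)

/-- The last point fixes the colour of its block, so sorting by the size of that block suffices. The
slack in `N` allows a common summation range later. -/
theorem altSum_eq {c : ℕ} (hc : c < 2) {i j : ℕ} (hij : i < j) (hj : (j - 1) % 2 = c) {N : ℕ}
    (hN : j - i ≤ N) : altSum κ i j = ∑ p ∈ range (N + 1), κ c p * altSumL κ c i j p := by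
  simp only [altSumL, mul_sum]
  rw [sum_comm]
  refine sum_congr rfl fun P hP => ?_
  rw [mem_NCI] at hP
  have hL := hP.blk_mem (x := j - 1) (by omega) (by omega)
  rw [prod_parts hP hij, altWeight_eq κ hc hL.2 hj]
  simp only [mul_ite, mul_zero, ite_and]
  have hcard : (blk P (j - 1)).card < N + 1 := Nat.lt_succ_of_le
    ((card_le_of_subset_interval fun _ hx => hP.blk_subset hx).trans hN)
  rw [sum_ite_eq, ite_mul, zero_mul, if_pos (mem_range.2 hcard)]

/-- The generating series of the gaps between consecutive points of the colour `c` in a block. -/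
def gapSeries (c : ℕ) : R⟦X⟧ :=
  PowerSeries.X * PowerSeries.mk fun n => altSum κ (1 - c) (1 - c + 2 * n + 1)

/-- The generating series of the alternating words of even length that end with the colour `c`. -/
def evenSeries (c : ℕ) : R⟦X⟧ :=
  1 + PowerSeries.subst (gapSeries κ c) (PowerSeries.mk (κ c))

theorem constantCoeff_gapSeries (c : ℕ) : PowerSeries.constantCoeff (gapSeries κ c) = 0 := by
  simp [gapSeries]

theorem sum_Ico_two_mul {M : Type*} [AddCommMonoid M] (F : ℕ → M) (i n : ℕ) :
    ∑ m ∈ Ico i (i + 2 * n), F m = ∑ s ∈ range n, (F (i + 2 * s) + F (i + 2 * s + 1)) := by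
  induction n with
  | zero => simp
  | succ n ih =>
    rw [sum_range_succ, ← ih, show i + 2 * (n + 1) = i + 2 * n + 1 + 1 by ring,
      sum_Ico_succ_top (by omega), sum_Ico_succ_top (by omega), add_assoc]

/-- The word starts and ends with colour `c`. Before the smallest point of its last block stands an
even word ending with colour `1 - c`; between consecutive points of the block stand odd gaps. This
gives one factor `evenSeries` and a substitution of `gapSeries`. -/
theorem altSum_odd_of {n : ℕ}
    (h1 : ∀ m ≤ n, ∀ c < 2, ∀ i, i % 2 ≠ c → ∀ p, altSumL κ c i (i + 2 * m) p =
      PowerSeries.coeff m (gapSeries κ c ^ p))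
    (h2 : ∀ m ≤ n, ∀ c < 2, ∀ i, i % 2 ≠ c → altSum κ i (i + 2 * m) =
      PowerSeries.coeff m (evenSeries κ c))
    {c : ℕ} (hc : c < 2) {i : ℕ} (hi : i % 2 = c) : altSum κ i (i + 2 * n + 1) =
      PowerSeries.coeff n (evenSeries κ (1 - c) *
        PowerSeries.subst (gapSeries κ c) (PowerSeries.mk fun p => κ c (p + 1))) := by
  have h3 : ∀ p, altSumL κ c i (i + 2 * n + 1) (p + 1) = ∑ s ∈ range (n + 1),
      PowerSeries.coeff s (evenSeries κ (1 - c)) *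
        PowerSeries.coeff (n - s) (gapSeries κ c ^ p) := by
    intro p
    rw [altSumL_succ κ c (by omega), sum_Ico_succ_top (by omega), sum_Ico_two_mul,
      sum_range_succ]
    congr 1
    · refine sum_congr rfl fun s hs => ?_
      have hs := mem_range.1 hs
      rw [if_pos (by omega), if_neg (by omega), add_zero, h2 s (by omega) (1 - c) (by omega) i
        (by omega)]
      have := h1 (n - s) (by omega) c hc (i + 2 * s + 1) (by omega) p
      rw [show i + 2 * s + 1 + 2 * (n - s) = i + 2 * n + 1 by omega] at this
      rw [this]
    · rw [if_pos (by omega), h2 n le_rfl (1 - c) (by omega) i (by omega)]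
      have := h1 0 (by omega) c hc (i + 2 * n + 1) (by omega) p
      rw [Nat.sub_self, ← this]
  rw [altSum_eq κ hc (by omega) (by omega) (N := 2 * n + 1) (by omega), sum_range_succ',
    altSumL_zero κ c (by omega), mul_zero, add_zero, PowerSeries.coeff_mul,
    Nat.sum_antidiagonal_eq_sum_range_succ_mk]
  simp_rw [h3, mul_sum]
  rw [sum_comm]
  refine sum_congr rfl fun s hs => ?_
  have hs := mem_range.1 hs
  rw [coeff_subst_eq_sum (constantCoeff_gapSeries κ c), mul_sum]
  symm
  refine sum_subset_zero_on_sdiff (range_subset_range.2 (by omega)) (fun p hp => ?_) fun p _ => ?_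
  · have : n - s < p := by
      have := (mem_sdiff.1 hp).2
      simp at this
      omega
    rw [coeff_pow_eq_zero (constantCoeff_gapSeries κ c) this, mul_zero, mul_zero]
  · rw [PowerSeries.coeff_mk]
    ring

/-- An even word ending with colour `c` starts with the other colour. Hence every point of its last
block is preceded by an odd gap, which together with that point has even length `2n + 2`; this
accounts for the factor `X` in `gapSeries`, where `X` marks two letters. -/
theorem altSum_even_and (hκ : ∀ c, κ c 0 = 0) (n : ℕ) :
    (∀ c < 2, ∀ i, i % 2 ≠ c → ∀ p, altSumL κ c i (i + 2 * n) p =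
      PowerSeries.coeff n (gapSeries κ c ^ p)) ∧
    (∀ c < 2, ∀ i, i % 2 ≠ c → altSum κ i (i + 2 * n) =
      PowerSeries.coeff n (evenSeries κ c)) := by
  induction n using Nat.strong_induction_on with
  | _ n ih =>
    -- Odd sums depend only on the length and the starting colour, so a gap at any position may be
    -- moved to the standard position used in `gapSeries`.
    have hodd : ∀ m < n, ∀ c < 2, ∀ i, i % 2 = c → altSum κ i (i + 2 * m + 1) =
        altSum κ c (c + 2 * m + 1) := by
      intro m hm c hc i hi
      rw [altSum_odd_of κ (fun m' h => (ih m' (by omega)).1) (fun m' h => (ih m' (by omega)).2)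
        hc hi, altSum_odd_of κ (fun m' h => (ih m' (by omega)).1)
        (fun m' h => (ih m' (by omega)).2) hc (Nat.mod_eq_of_lt hc)]
    have h1 : ∀ c < 2, ∀ i, i % 2 ≠ c → ∀ p, altSumL κ c i (i + 2 * n) p =
        PowerSeries.coeff n (gapSeries κ c ^ p) := by
      intro c hc i hi p
      rcases n.eq_zero_or_pos with rfl | hn
      · rw [mul_zero, add_zero, altSumL_self]
        rcases p with _ | p <;> simp [constantCoeff_gapSeries]
      · rcases p with _ | p
        · rw [altSumL_zero κ c (by omega), pow_zero, PowerSeries.coeff_one, if_neg (by omega)]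
        · rw [altSumL_succ κ c (by omega), sum_Ico_two_mul, pow_succ]
          nth_rw 2 [gapSeries]
          rw [coeff_mul_X_mul, ← sum_range_reflect]
          refine sum_congr rfl fun k hk => ?_
          have hk := mem_range.1 hk
          have h2 := (ih k hk).1 c hc (i + 2 * (n - 1 - k) + 1 + 1) (by omega) p
          rw [show i + 2 * (n - 1 - k) + 1 + 1 + 2 * k = i + 2 * n by omega] at h2
          rw [if_neg (by omega), if_pos (by omega), zero_add, h2, mul_comm,
            hodd (n - 1 - k) (by omega) (1 - c) (by omega) i (by omega)]
    refine ⟨h1, fun c hc i hi => ?_⟩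
    rw [evenSeries, map_add, PowerSeries.coeff_one,
      coeff_subst_eq_sum (constantCoeff_gapSeries κ c)]
    rcases n.eq_zero_or_pos with rfl | hn
    · simp [altSum_self, hκ]
    · rw [if_neg (by omega), zero_add,
        altSum_eq κ hc (by omega) (by omega) (N := 2 * n) (by omega)]
      simp_rw [h1 c hc i hi, PowerSeries.coeff_mk]
      symm
      refine sum_subset (range_subset_range.2 (by omega)) fun p _ hp => ?_
      have : n < p := by
        simp at hp
        omega
      rw [coeff_pow_eq_zero (constantCoeff_gapSeries κ c) this, mul_zero]

theorem gapSeries_eq (hκ : ∀ c, κ c 0 = 0) {c : ℕ} (hc : c < 2) :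
    gapSeries κ (1 - c) = PowerSeries.X * (evenSeries κ (1 - c) *
      PowerSeries.subst (gapSeries κ c) (divX (PowerSeries.mk (κ c)))) := by
  conv_lhs => rw [gapSeries]
  congr 1
  ext n
  rw [PowerSeries.coeff_mk, show 1 - (1 - c) = c by omega,
    altSum_odd_of κ (fun m _ => (altSum_even_and κ hκ m).1) (fun m _ => (altSum_even_and κ hκ m).2)
      hc (Nat.mod_eq_of_lt hc)]
  simp only [divX, PowerSeries.coeff_mk]

/-- The transform `𝓕` of the series of the words `(ab)ⁿ` for free `a`, `b`. -/
theorem transF_altSum (f : ℕ → SeriesG R) :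
    ∃ h : SeriesG R, (∀ n ≠ 0, PowerSeries.coeff n h.1.1 =
        altSum (fun c n => PowerSeries.coeff n (f c).1.1) 0 (2 * n)) ∧
      transF (f 0) * transF (f 1) = transF h * (1 + PowerSeries.X) := by
  set κ : ℕ → ℕ → R := fun c n => PowerSeries.coeff n (f c).1.1 with hκdef
  have hκ : ∀ c, κ c 0 = 0 := fun c => SeriesM.coeff_zero _
  have hmk : ∀ c, PowerSeries.mk (κ c) = (f c).1.1 := fun c => by ext n; simp [κ]
  have hg := constantCoeff_gapSeries κ
  have e : ∀ c, evenSeries κ c = 1 + gapSeries κ c *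
      PowerSeries.subst (gapSeries κ c) (divX (f c).1.1) := fun c => by
    rw [evenSeries, hmk, ← subst_eq_mul_divX (f c).1.2 (hg c)]
  have g0 : gapSeries κ 0 = PowerSeries.X * (evenSeries κ 0 *
      PowerSeries.subst (gapSeries κ 1) (divX (f 1).1.1)) := by
    simpa only [hmk] using gapSeries_eq κ hκ (c := 1) (by omega)
  have g1 : gapSeries κ 1 = PowerSeries.X * (evenSeries κ 1 *
      PowerSeries.subst (gapSeries κ 0) (divX (f 0).1.1)) := by
    simpa only [hmk] using gapSeries_eq κ hκ (c := 0) (by omega)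
  -- With `E₀`, `E₁` for the two even series, the product of the two gap series is both `X·E₀·(E₁ -
  -- 1)` and `X·E₁·(E₀ - 1)`.
  have h01 : evenSeries κ 0 = evenSeries κ 1 := by
    apply PowerSeries.X_mul_cancel
    linear_combination gapSeries κ 1 * g0 - gapSeries κ 0 * g1
      - PowerSeries.X * evenSeries κ 0 * e 1 + PowerSeries.X * evenSeries κ 1 * e 0
  have hconst : ∀ c, PowerSeries.constantCoeff
      (PowerSeries.subst (gapSeries κ c) (divX (f c).1.1)) = 1 := fun c => by
    rw [← PowerSeries.coeff_zero_eq_constantCoeff_apply, coeff_subst_eq_sum (hg c)]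
    simp [divX, (f c).2]
  have hM : PowerSeries.constantCoeff (evenSeries κ 1) = 1 := by
    rw [e 1]
    simp [hg]
  let h : SeriesG R := ⟨⟨evenSeries κ 1 - 1, by simp [RingHom.mem_ker, hM]⟩, by
    change PowerSeries.coeff (0 + 1) (evenSeries κ 1 - 1) = 1
    have : evenSeries κ 1 - 1 = PowerSeries.X * (evenSeries κ 1 *
        PowerSeries.subst (gapSeries κ 0) (divX (f 0).1.1) *
          PowerSeries.subst (gapSeries κ 1) (divX (f 1).1.1)) := by
      linear_combination e 1 + PowerSeries.subst (gapSeries κ 1) (divX (f 1).1.1) * g1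
    rw [this, PowerSeries.coeff_succ_X_mul, PowerSeries.coeff_zero_eq_constantCoeff_apply,
      map_mul, map_mul, hM, hconst, hconst, mul_one, mul_one]⟩
  have hh : h.1.1 = evenSeries κ 1 - 1 := rfl
  refine ⟨h, fun n hn => ?_, ?_⟩
  · have := (altSum_even_and κ hκ n).2 1 (by omega) 0 (by omega)
    rw [zero_add] at this
    rw [this, hh, map_sub, PowerSeries.coeff_one, if_neg hn, sub_zero]
  · have hs := hasSubst_of_mem h.1
    refine transF_mul_transF (hg 0) (hg 1) ?_ ?_ ?_
    · rw [hh, ← h01, e 0, ← subst_eq_mul_divX (f 0).1.2 (hg 0)]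
      ring
    · rw [hh, e 1, ← subst_eq_mul_divX (f 1).1.2 (hg 1)]
      ring
    -- The product of the gap series is `X·h·(1+h)`, which is the case `u = 1 + X`.
    · rw [PowerSeries.subst_add hs, PowerSeries.subst_X hs, subst_one hs, hh]
      linear_combination gapSeries κ 1 * g0 - PowerSeries.X * evenSeries κ 0 * e 1 +
        PowerSeries.X * (evenSeries κ 1 - 1) * h01

end Alternating

/-! ## Moments and free cumulants -/

section FreeProduct

variable {k R A : Type*} [Field k] [CommRing R] [Algebra k R] [Ring A] [Algebra k A]

theorem coeff_mu (φ : A →ₗ[k] R) (a : A) {n : ℕ} (hn : n ≠ 0) :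
    PowerSeries.coeff n (mu φ a).1 = φ (a ^ n) := by
  rw [mu, functionalSeries, SeriesM.coeff_mk _ hn]
  simp [distribution]

theorem seriesM_ext {f g : SeriesM R}
    (h : ∀ n ≠ 0, PowerSeries.coeff n f.1 = PowerSeries.coeff n g.1) : f = g := by
  apply Subtype.ext
  ext n
  rcases eq_or_ne n 0 with rfl | hn
  · rw [SeriesM.coeff_zero, SeriesM.coeff_zero]
  · exact h n hn

theorem mu_zero (φ : A →ₗ[k] R) : mu φ 0 = 0 :=
  seriesM_ext fun n hn => by rw [coeff_mu φ 0 hn, zero_pow hn, map_zero]; simp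

theorem mu_one (φ : A →ₗ[k] R) (hφ : φ 1 = 1) : mu φ 1 = zeta R :=
  seriesM_ext fun n hn => by rw [coeff_mu φ 1 hn, one_pow, hφ, zeta, SeriesM.coeff_mk _ hn]

/-- The series of the free cumulants of `a`. -/
def cumulantSeries (φ : A →ₗ[k] R) (a : A) : SeriesM R :=
  SeriesM.mk fun n => cumulant φ n fun _ => a

/-- This is the moment-cumulant formula for a constant tuple: the coefficients of `Zeta₁` are `1`,
so the complement blocks contribute nothing. -/
theorem mu_eq_boxConv (φ : A →ₗ[k] R) (a : A) :
    mu φ a = boxConv (cumulantSeries φ a) (zeta R) := by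
  refine seriesM_ext fun n hn => ?_
  have h := moment_cumulant φ hn fun _ => a
  rw [List.ofFn_const, List.prod_replicate] at h
  rw [coeff_mu φ a hn, h, boxConv, SeriesM.coeff_mk _ hn]
  refine sum_congr rfl fun π _ => ?_
  have hne : ∀ (σ : Part n), ∀ V ∈ σ.parts, V.card ≠ 0 := fun σ V hV =>
    (card_pos.2 (σ.nonempty_of_mem_parts hV)).ne'
  rw [zeta, prod_eq_one fun W hW => SeriesM.coeff_mk (R := R) (fun _ => 1)
    (hne (kreweras π) W hW), mul_one, cumulantSeries]
  exact prod_congr rfl fun V hV =>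
    (SeriesM.coeff_mk (fun n => cumulant φ n fun _ => a) (hne π V hV)).symm

theorem coeff_one_cumulantSeries (φ : A →ₗ[k] R) (a : A) :
    PowerSeries.coeff 1 (cumulantSeries φ a).1 = φ a := by
  rw [← coeff_one_mu, mu_eq_boxConv, coeff_one_boxConv _ (zeta R) (zetaG R).2]

/-- The series of the free cumulants of `a`, if `φ(a) = 1`. -/
def cumulantSeriesG (φ : A →ₗ[k] R) (a : A) (ha : φ a = 1) : SeriesG R :=
  ⟨cumulantSeries φ a, (coeff_one_cumulantSeries φ a).trans ha⟩

theorem muG_eq_boxRightG (φ : A →ₗ[k] R) (a : A) (ha : φ a = 1) :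
    muG φ a ha = boxRightG (zetaG R) (cumulantSeriesG φ a ha) :=
  Subtype.ext (mu_eq_boxConv φ a)

theorem prod_ofFn_alternating (a b : A) (n : ℕ) :
    (List.ofFn fun i : Fin (2 * n) => if (i : ℕ) % 2 = 0 then a else b).prod = (a * b) ^ n := by
  have h : ∀ m, (List.ofFn fun i : Fin m => if (i : ℕ) % 2 = 0 then a else b) =
      (List.range m).map fun i => if i % 2 = 0 then a else b := fun m =>
    List.ext_getElem (by simp) (by simp)
  rw [h]
  induction n with
  | zero => simp
  | succ n ih =>
    rw [show 2 * (n + 1) = 2 * n + 1 + 1 by ring, List.range_succ, List.range_succ, List.map_append,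
      List.map_append, List.prod_append, List.prod_append, ih, pow_succ, mul_assoc]
    simp [Nat.add_mod]

theorem cumulant_alternating {φ : A →ₗ[k] R} {a b : A}
    (hab : CombFree φ ![({a} : Set A), {b}]) {n : ℕ} {V : Finset (Fin n)} (hV : V.Nonempty) :
    cumulant φ V.card (fun i => if (V.orderEmbOfFin rfl i : ℕ) % 2 = 0 then a else b) =
      altWeight (fun c n => PowerSeries.coeff n (cumulantSeries φ (if c = 0 then a else b)).1)
        (V.map Fin.valEmbedding) := by
  have hcard : V.card ≠ 0 := (card_pos.2 hV).ne'
  have hmem := fun i => orderEmbOfFin_mem V rfl i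
  have hall : ∀ c, (∀ v ∈ V.map Fin.valEmbedding, v % 2 = c) ↔ ∀ v ∈ V, (v : ℕ) % 2 = c := by
    simp
  rw [altWeight]
  simp only [hall, card_map, if_true, one_ne_zero, if_false]
  simp only [cumulantSeries, SeriesM.coeff_mk _ hcard]
  split_ifs with h0 h1
  · simp only [h0 _ (hmem _), if_true]
  · simp only [h1 _ (hmem _), one_ne_zero, if_false]
  -- The block contains positions of both parities, so its cumulant has both `a` and `b` among its
  -- arguments and vanishes by freeness.
  · push Not at h0 h1
    obtain ⟨x, hx, hx'⟩ := h0
    obtain ⟨y, hy, hy'⟩ := h1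
    have hsurj : ∀ v ∈ V, ∃ i, V.orderEmbOfFin rfl i = v := fun v hv => by
      have : v ∈ Set.range (V.orderEmbOfFin rfl) := by rw [range_orderEmbOfFin]; exact hv
      exact this
    obtain ⟨s, hs⟩ := hsurj x hx
    obtain ⟨t, ht⟩ := hsurj y hy
    refine hab _ (fun i => if (V.orderEmbOfFin rfl i : ℕ) % 2 = 0 then 0 else 1) _ (fun i => ?_)
      ⟨s, t, ?_⟩
    · split_ifs <;> simp
    · rw [hs, ht, if_neg hx', if_pos (by omega)]
      simp

/-- Here `(ab)ⁿ` is read as a word in `2n` letters and its moment is expanded in cumulants of single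
letters, so that freeness applies. -/
theorem coeff_mu_mul {φ : A →ₗ[k] R} {a b : A} (hab : CombFree φ ![({a} : Set A), {b}])
    {n : ℕ} (hn : n ≠ 0) : PowerSeries.coeff n (mu φ (a * b)).1 =
      altSum (fun c n => PowerSeries.coeff n (cumulantSeries φ (if c = 0 then a else b)).1)
        0 (2 * n) := by
  rw [coeff_mu φ _ hn, ← prod_ofFn_alternating, moment_cumulant φ (by omega), altSum,
    ← sum_NC_eq_sum_NCI]
  refine sum_congr rfl fun π _ => ?_
  rw [prod_natParts]
  exact prod_congr rfl fun V hV => cumulant_alternating hab (π.nonempty_of_mem_parts hV)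

/-- The multiplicative free convolution: `μ_{ab} = μ_a ⊠_V μ_b`. -/
theorem mu_mul {φ : A →ₗ[k] R} {a b : A} (hab : CombFree φ ![({a} : Set A), {b}])
    (ha : φ a = 1) (hb : φ b = 1) :
    mu φ (a * b) = (boxRightG (muG φ b hb) (boxRightG (moebG R) (muG φ a ha))).1 := by
  let f : ℕ → SeriesG R := fun c => if c = 0 then cumulantSeriesG φ a ha else cumulantSeriesG φ b hb
  obtain ⟨h, h1, h2⟩ := transF_altSum f
  have h3 : mu φ (a * b) = h.1 := seriesM_ext fun n hn => by
    rw [coeff_mu_mul hab hn, h1 n hn]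
    congr 1
    funext c n
    by_cases hc : c = 0 <;> simp [f, hc, cumulantSeriesG]
  rw [h3]
  refine congrArg Subtype.val (transF_injective ?_)
  -- After cancelling `Zeta₁` against `Moeb₁`, what remains is `𝓕(h) = 𝓕(κ_a)·𝓕(κ_b)·𝓕(Zeta₁)`,
  -- where `𝓕(Zeta₁)` is the inverse of `1+z`.
  rw [muG_eq_boxRightG, muG_eq_boxRightG, boxRightG_zetaG_moebG, transF_boxRightG,
    transF_boxRightG]
  have h4 : transF (f 0) = transF (cumulantSeriesG φ a ha) := rfl
  have h5 : transF (f 1) = transF (cumulantSeriesG φ b hb) := rfl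
  rw [h4, h5] at h2
  linear_combination -transF h * transF_zetaG (R := R) - transF (zetaG R) * h2

end FreeProduct

end FreeProb

end

/-- `EXP_V` as an exponential for distributions. The ring `R` carries the `ℚ`-algebra structure that
comes from the field `k` of characteristic zero. -/
theorem mainTheorem12 {k R A : Type*} [Field k] [CharZero k] [CommRing R] [Algebra k R]
    [Ring A] [Algebra k A] (φ : A →ₗ[k] R) (hφ : φ 1 = 1) (a b : A)
    (hab : FreeProb.CombFree φ ![({a} : Set A), {b}]) :
    letI : Algebra ℚ R := Algebra.compHom R (algebraMap ℚ k)
    ((FreeProb.EXPV (FreeProb.mu φ 0)).1 = FreeProb.mu φ 1 ∧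
      FreeProb.mu φ 1 = FreeProb.zeta R) ∧
    (FreeProb.EXPV (FreeProb.boxPlusV (FreeProb.mu φ a) (FreeProb.mu φ b))).1 =
      FreeProb.boxTimesV (FreeProb.EXPV (FreeProb.mu φ a)).1 (FreeProb.EXPV (FreeProb.mu φ b)).1 ∧
    ∀ (ha : φ a = 1) (hb : φ b = 1), φ (a * b) = 1 ∧
      FreeProb.mu φ (a * b) =
        (FreeProb.EXPV (FreeProb.boxPlusV (FreeProb.LOGV (FreeProb.muG φ a ha))
          (FreeProb.LOGV (FreeProb.muG φ b hb)))).1 := by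
  let : Algebra ℚ R := Algebra.compHom R (algebraMap ℚ k)
  refine ⟨⟨?_, FreeProb.mu_one φ hφ⟩, congrArg Subtype.val (FreeProb.EXPV_boxPlusV _ _),
    fun ha hb => ?_⟩
  · rw [FreeProb.mu_zero, FreeProb.EXPV_zero, FreeProb.mu_one φ hφ]
    rfl
  · have h := FreeProb.mu_mul hab ha hb
    refine ⟨?_, ?_⟩
    -- The first moment of `ab` is the linear coefficient of a series that lies in `𝔊¹₊(R)`.
    · rw [← FreeProb.coeff_one_mu, h]
      exact (FreeProb.boxRightG _ _).2
    · rw [h, FreeProb.EXPV_boxPlusV]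
      simp only [FreeProb.LOGV, Equiv.apply_symm_apply]
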